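/- Let $d\ge 0$ be an integer and let $\mathbf{F}_{2d}\to\mathbf{P}^1$ be the complex ruled surface that compactifies the line bundle $\mathcal{O}(2d)$ on $\mathbf{P}^1$ by a section at infinity $C_\infty$ (so $C_\infty^2=-2d$); let $F$ be a fibre. Let $\pi:X\to\mathbf{F}_{2d}$ be the Weierstrass model $y^2=x^3+a_2x^2+a_4x+a_6$, where $a_i$ is a binary form of degree $id$ on $\mathbf{P}^1$ and $x$ is the fibre coordinate of $\mathcal{O}(2d)$; that is, $X$ is the double cover of $\mathbf{F}_{2d}$ branched along $C_\infty\sqcup\mathcal{C}$, where $\mathcal{C}\subset\mathcal{O}(2d)$ is the trigonal curve $x^3+a_2x^2+a_4x+a_6=0$. Assume that $\mathcal{C}$ is smooth and irreducible (so that $d\geq 1$). Then $\mathcal{C}$ has genus $6d-2$. Moreover, let $\theta=(2d-1)F_{|\mathcal{C}}$ be the restriction to $\mathcal{C}$ of the divisor class $(2d-1)F$. Then $\theta$ is a theta characteristic on $\mathcal{C}$ (that is, $2\theta=K_{\mathcal{C}}$ in $\mathrm{Pic}(\mathcal{C})$), it is even (that is, $h^0(\mathcal{C},\theta)$ is even),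 and $$\dim H^0(\mathcal{C},\theta)=2d.$$ -/

import Mathlib

open MvPolynomial

noncomputable section

namespace Ruled

/-! ### The ruled surface `F_e`

`F_e` is the quotient of `(ℂ² ∖ 0) × (ℂ² ∖ 0)`, with homogeneous coordinates `(s, t, x, z)` indexed
by `0, 1, 2, 3`, by the torus `(l, m) • (s, t, x, z) = (l s, l t, lᵉ m x, m z)`. The projection to
the projective line is `(s : t)`; the open set `z ≠ 0` is the line bundle `O(e)` with fibre
coordinate `x / z`, and `z = 0` is the section at infinity. -/

/-- Homogeneous coordinate vectors of points of `F_e`. -/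
def Coord : Type :=
  {v : Fin 4 → ℂ // (v 0 ≠ 0 ∨ v 1 ≠ 0) ∧ (v 2 ≠ 0 ∨ v 3 ≠ 0)}

/-- The action of the torus on coordinate vectors. -/
def act (e : ℕ) (l m : ℂˣ) (v : Fin 4 → ℂ) : Fin 4 → ℂ :=
  ![l * v 0, l * v 1, (l : ℂ) ^ e * m * v 2, m * v 3]

lemma act_one (e : ℕ) (v : Fin 4 → ℂ) : act e 1 1 v = v := by
  funext i; fin_cases i <;> simp [act]

lemma act_act (e : ℕ) (l m l' m' : ℂˣ) (v : Fin 4 → ℂ) :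
    act e l m (act e l' m' v) = act e (l * l') (m * m') v := by
  funext i; fin_cases i <;> simp [act, mul_pow] <;> ring

/-- The action of the torus is free. -/
lemma act_free (e : ℕ) (l m : ℂˣ) (v : Coord) (h : v.1 = act e l m v.1) : l = 1 ∧ m = 1 := by
  have h0 := congrFun h 0
  have h1 := congrFun h 1
  have h2 := congrFun h 2
  have h3 := congrFun h 3
  simp only [act, Matrix.cons_val] at h0 h1 h2 h3
  have hl : (l : ℂ) = 1 := by
    rcases v.2.1 with h | h
    · exact mul_right_cancel₀ h (by rw [← h0, one_mul])
    · exact mul_right_cancel₀ h (by rw [← h1, one_mul])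
  have hm : (m : ℂ) = 1 := by
    rcases v.2.2 with h | h
    · refine mul_right_cancel₀ h ?_
      rw [hl, one_pow, one_mul] at h2
      rw [← h2, one_mul]
    · exact mul_right_cancel₀ h (by rw [← h3, one_mul])
  exact ⟨Units.ext hl, Units.ext hm⟩

/-- Two coordinate vectors define the same point of `F_e` iff they are in one torus orbit. -/
def coordSetoid (e : ℕ) : Setoid Coord where
  r v w := ∃ l m : ℂˣ, w.1 = act e l m v.1
  iseqv :=
    { refl := fun v => ⟨1, 1, (act_one e v.1).symm⟩
      symm := by
        rintro v w ⟨l, m, h⟩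
        exact ⟨l⁻¹, m⁻¹, by rw [h, act_act]; simp [act_one]⟩
      trans := by
        rintro u v w ⟨l, m, h⟩ ⟨l', m', h'⟩
        exact ⟨l' * l, m' * m, by rw [h', h, act_act]⟩ }

/-- The (closed points of the) ruled surface `F_e`. -/
def Surface (e : ℕ) : Type := Quotient (coordSetoid e)

/-- The point of `F_e` with given homogeneous coordinates. -/
def mk (e : ℕ) (v : Coord) : Surface e := Quotient.mk (coordSetoid e) v

lemma mk_eq_mk {e : ℕ} {v w : Coord} :
    mk e v = mk e w ↔ ∃ l m : ℂˣ, w.1 = act e l m v.1 :=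
  Quotient.eq (r := coordSetoid e)

/-- The bidegrees of the homogeneous coordinates `s, t, x, z`. A polynomial that is homogeneous of
bidegree `(a, b)` is a section of the line bundle of the divisor class `a F + b C_∞`. -/
def weight (e : ℕ) : Fin 4 → ℕ × ℕ := ![(1, 0), (1, 0), (e, 1), (0, 1)]

/-- The polynomial `A` is bihomogeneous of bidegree `n`. -/
abbrev IsBihom (e : ℕ) (A : MvPolynomial (Fin 4) ℂ) (n : ℕ × ℕ) : Prop :=
  IsWeightedHomogeneous (weight e) A n

/-- The points of `F_e` at which `A` vanishes (used for bihomogeneous `A`, for which the choice of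
the coordinate vector does not matter). -/
def zeroLocus (e : ℕ) (A : MvPolynomial (Fin 4) ℂ) : Set (Surface e) :=
  {p | ∃ v : Coord, mk e v = p ∧ eval v.1 A = 0}

/-- The section at infinity `C_∞`. -/
def sectionAtInfinity (e : ℕ) : Set (Surface e) := zeroLocus e (X 3)

/-- The linear form in `s, t` that vanishes at the point `c = (c 0 : c 1)` of the projective line;
its zero locus is the fibre of `F_e` over `c`. -/
def fibreForm (c : Fin 2 → ℂ) : MvPolynomial (Fin 4) ℂ := C (c 1) * X 0 - C (c 0) * X 1

lemma isBihom_X0 (e : ℕ) : IsBihom e (X 0) (1, 0) := isWeightedHomogeneous_X ℂ (weight e) 0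
lemma isBihom_X1 (e : ℕ) : IsBihom e (X 1) (1, 0) := isWeightedHomogeneous_X ℂ (weight e) 1

lemma isBihom_C (e : ℕ) (a : ℂ) : IsBihom e (C a) 0 := isWeightedHomogeneous_C (weight e) a

lemma isBihom_add {e : ℕ} {A B : MvPolynomial (Fin 4) ℂ} {n : ℕ × ℕ}
    (hA : IsBihom e A n) (hB : IsBihom e B n) : IsBihom e (A + B) n :=
  (weightedHomogeneousSubmodule ℂ (weight e) n).add_mem hA hB

lemma isBihom_fibreForm (e : ℕ) (c : Fin 2 → ℂ) : IsBihom e (fibreForm c) (1, 0) := by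
  have h1 := (isBihom_C e (c 1)).mul (isBihom_X0 e)
  have h0 := (isBihom_C e (c 0)).mul (isBihom_X1 e)
  rw [zero_add] at h0 h1
  exact (weightedHomogeneousSubmodule ℂ (weight e) (1, 0)).sub_mem h1 h0

end Ruled

open Ruled

/-- The data of a Weierstrass equation `y² = x³ + a₂ x² + a₄ x + a₆` over the projective line, with
`aᵢ` a binary form of degree `i d` (a global section of `O(i d)`). -/
structure WeierstrassModel (d : ℕ) where
  a₂ : MvPolynomial (Fin 2) ℂ
  a₄ : MvPolynomial (Fin 2) ℂ
  a₆ : MvPolynomial (Fin 2) ℂ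
  hom₂ : a₂.IsHomogeneous (2 * d)
  hom₄ : a₄.IsHomogeneous (4 * d)
  hom₆ : a₆.IsHomogeneous (6 * d)

namespace WeierstrassModel

variable {d : ℕ} (W : WeierstrassModel d)

/-- Binary forms in `s, t` as polynomials in `s, t, x, z`. -/
def lift (a : MvPolynomial (Fin 2) ℂ) : MvPolynomial (Fin 4) ℂ := rename ![0, 1] a

/-- The bihomogeneous form `x³ + a₂ x² z + a₄ x z² + a₆ z³` on `F_{2d}`. -/
def cubic : MvPolynomial (Fin 4) ℂ :=
  X 2 ^ 3 + lift W.a₂ * X 2 ^ 2 * X 3 + lift W.a₄ * X 2 * X 3 ^ 2 + lift W.a₆ * X 3 ^ 3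

lemma eval_lift (a : MvPolynomial (Fin 2) ℂ) (v : Fin 4 → ℂ) :
    eval v (lift a) = eval ![v 0, v 1] a := by
  rw [lift, eval_rename]
  congr 2
  funext i; fin_cases i <;> simp

lemma eval_cubic (v : Fin 4 → ℂ) : eval v W.cubic =
    v 2 ^ 3 + eval ![v 0, v 1] W.a₂ * v 2 ^ 2 * v 3 + eval ![v 0, v 1] W.a₄ * v 2 * v 3 ^ 2
      + eval ![v 0, v 1] W.a₆ * v 3 ^ 3 := by
  simp [cubic, eval_lift]

lemma eval_homog {a : MvPolynomial (Fin 2) ℂ} {n : ℕ} (ha : a.IsHomogeneous n) (l u v : ℂ) :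
    eval ![l * u, l * v] a = l ^ n * eval ![u, v] a := by
  rw [eval_eq, eval_eq, Finset.mul_sum]
  refine Finset.sum_congr rfl fun k hk => ?_
  have hdeg : k 0 + k 1 = n := by
    have h := ha (mem_support_iff.1 hk)
    rwa [Finsupp.weight_apply, Finsupp.sum_fintype _ _ (by simp), Fin.sum_univ_two,
      Pi.one_apply, Pi.one_apply, smul_eq_mul, smul_eq_mul, mul_one, mul_one] at h
  rw [Finset.prod_subset (Finset.subset_univ _), Finset.prod_subset (Finset.subset_univ k.support),
    Fin.prod_univ_two, Fin.prod_univ_two, ← hdeg]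
  · simp only [Matrix.cons_val]
    ring
  all_goals
    intro i _ hi
    rw [Finsupp.notMem_support_iff.1 hi, pow_zero]

lemma eval_cubic_act (l m : ℂˣ) (v : Fin 4 → ℂ) :
    eval (act (2 * d) l m v) W.cubic = (l : ℂ) ^ (6 * d) * (m : ℂ) ^ 3 * eval v W.cubic := by
  simp only [eval_cubic, act, Matrix.cons_val, eval_homog W.hom₂, eval_homog W.hom₄,
    eval_homog W.hom₆]
  ring

/-! ### The double cover -/

/-- Coordinates of the double cover `w² = z · cubic`, inside the line bundle of the class
`3d F + 2 C_∞` on `F_{2d}`. -/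
def CoverCoord : Type :=
  {q : Coord × ℂ // q.2 ^ 2 = q.1.1 3 * eval q.1.1 W.cubic}

/-- The torus acts on the coordinate `w` with weight `(3d, 2)`. -/
def coverSetoid : Setoid W.CoverCoord where
  r q q' := ∃ l m : ℂˣ, q'.1.1.1 = act (2 * d) l m q.1.1.1 ∧
    q'.1.2 = (l : ℂ) ^ (3 * d) * (m : ℂ) ^ 2 * q.1.2
  iseqv :=
    { refl := fun q => ⟨1, 1, (act_one _ _).symm, by simp⟩
      symm := by
        rintro q q' ⟨l, m, h, h'⟩
        refine ⟨l⁻¹, m⁻¹, by rw [h, act_act]; simp [act_one], ?_⟩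
        rw [h']
        have hl : (l : ℂ) ≠ 0 := l.ne_zero
        have hm : (m : ℂ) ≠ 0 := m.ne_zero
        simp only [Units.val_inv_eq_inv_val, inv_pow]
        field_simp
      trans := by
        rintro q q' q'' ⟨l, m, h, k⟩ ⟨l', m', h', k'⟩
        refine ⟨l' * l, m' * m, by rw [h', h, act_act], ?_⟩
        rw [k', k]
        push_cast
        ring }

/-- The Weierstrass model `X`: the double cover of `F_{2d}` with equation `w² = z · cubic`; where
`z = 1` this is the Weierstrass equation `w² = x³ + a₂ x² + a₄ x + a₆`. -/
def Cover : Type := Quotient W.coverSetoid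

/-- The covering map `π : X → F_{2d}`. -/
def coverMap : W.Cover → Surface (2 * d) :=
  Quotient.lift (s := W.coverSetoid) (fun q => Ruled.mk (2 * d) q.1.1) (by
    rintro q q' ⟨l, m, h, -⟩
    exact mk_eq_mk.2 ⟨l, m, h⟩)

/-- The branch locus of `π`: the points over which there is only one point. -/
def branchLocus : Set (Surface (2 * d)) := {p | ∃! q : W.Cover, W.coverMap q = p}

/-- The branch curve `𝒞`: the branch locus of `π` without the section at infinity. -/
def branchCurve : Set (Surface (2 * d)) := W.branchLocus \ sectionAtInfinity (2 * d)

lemma mk_mem_branchLocus (v : Coord) :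
    Ruled.mk (2 * d) v ∈ W.branchLocus ↔ v.1 3 * eval v.1 W.cubic = 0 := by
  constructor
  · rintro ⟨q, -, huniq⟩
    obtain ⟨w, hw⟩ := IsAlgClosed.exists_pow_nat_eq (v.1 3 * eval v.1 W.cubic) (n := 2) (by norm_num)
    let q₁ : W.CoverCoord := ⟨(v, w), hw⟩
    let q₂ : W.CoverCoord := ⟨(v, -w), by simpa using hw⟩
    have h₁ := huniq (Quotient.mk W.coverSetoid q₁) rfl
    have h₂ := huniq (Quotient.mk W.coverSetoid q₂) rfl
    obtain ⟨l, m, h, h'⟩ := (Quotient.eq (r := W.coverSetoid)).1 (h₁.trans h₂.symm)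
    obtain ⟨rfl, rfl⟩ := act_free _ l m v h
    have h0 : -w = w := by simpa [q₁, q₂] using h'
    have : w = 0 := by linear_combination (-1 / 2 : ℂ) * h0
    rw [← hw, this]; simp
  · intro h
    refine ⟨Quotient.mk W.coverSetoid ⟨(v, 0), by simp [h]⟩, rfl, ?_⟩
    intro q
    refine Quotient.inductionOn q (fun q hq => ?_)
    obtain ⟨⟨v', w⟩, hw⟩ := q
    obtain ⟨l, m, h'⟩ := mk_eq_mk.1 (show Ruled.mk (2 * d) v' = Ruled.mk (2 * d) v from hq)
    have hw0 : w = 0 := by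
      have e3 : v.1 3 = m * v'.1 3 := by rw [h']; simp [act]
      rw [h', eval_cubic_act, ← h', e3] at h
      have hl : (l : ℂ) ≠ 0 := l.ne_zero
      have hm : (m : ℂ) ≠ 0 := m.ne_zero
      have h2 : w ^ 2 = v'.1 3 * eval v'.1 W.cubic := hw
      have h3 : v'.1 3 * eval v'.1 W.cubic = 0 := by
        have : ((m : ℂ) * ((l : ℂ) ^ (6 * d) * (m : ℂ) ^ 3)) * (v'.1 3 * eval v'.1 W.cubic) = 0 := by
          linear_combination h
        exact (mul_eq_zero.1 this).resolve_left (by positivity)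
      rw [h3] at h2
      exact pow_eq_zero_iff (by norm_num) |>.1 h2
    refine Quotient.sound (s := W.coverSetoid) ⟨l, m, h', ?_⟩
    simp [hw0]

lemma mk_mem_sectionAtInfinity (e : ℕ) (v : Coord) :
    Ruled.mk e v ∈ sectionAtInfinity e ↔ v.1 3 = 0 := by
  constructor
  · rintro ⟨w, hw, h0⟩
    obtain ⟨l, m, h⟩ := mk_eq_mk.1 hw
    rw [eval_X] at h0
    rw [h]
    simp [act, h0]
  · intro h
    exact ⟨v, rfl, by rw [eval_X, h]⟩

/-- `𝒞` is the curve with equation `cubic = 0`. -/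
lemma mk_mem_branchCurve (v : Coord) :
    Ruled.mk (2 * d) v ∈ W.branchCurve ↔ eval v.1 W.cubic = 0 := by
  rw [branchCurve, Set.mem_sdiff, mk_mem_branchLocus, mk_mem_sectionAtInfinity]
  constructor
  · rintro ⟨h, h3⟩
    exact (mul_eq_zero.1 h).resolve_left h3
  · intro h
    refine ⟨by rw [h, mul_zero], fun h3 => ?_⟩
    rw [eval_cubic, h3] at h
    have h2 : v.1 2 = 0 := by simpa using h
    exact v.2.2.elim (fun k => k h2) (fun k => k h3)

/-- A fibre of `F_{2d}` meets `𝒞` in finitely many points. -/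
lemma finite_fibre (c : Fin 2 → ℂ) (hc : c ≠ 0) :
    (W.branchCurve ∩ zeroLocus (2 * d) (fibreForm c)).Finite := by
  have hc' : c 0 ≠ 0 ∨ c 1 ≠ 0 := by
    by_contra! h
    exact hc (funext fun i => by fin_cases i <;> simp [h])
  let Q : Polynomial ℂ := Polynomial.X ^ 3 + (Polynomial.C (eval ![c 0, c 1] W.a₂) *
    Polynomial.X ^ 2 + Polynomial.C (eval ![c 0, c 1] W.a₄) * Polynomial.X +
    Polynomial.C (eval ![c 0, c 1] W.a₆))
  have hQ : Q ≠ 0 :=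
    (Polynomial.monic_X_pow_add (n := 3) (by compute_degree!)).ne_zero
  let pt : ℂ → Surface (2 * d) := fun x =>
    Ruled.mk (2 * d) ⟨![c 0, c 1, x, 1], by simpa using hc'⟩
  refine ((Q.rootSet_finite ℂ).image pt).subset ?_
  rintro p ⟨hp, v, rfl, hv⟩
  have hG := (W.mk_mem_branchCurve v).1 hp
  have h3 : v.1 3 ≠ 0 := by
    intro h3
    rw [eval_cubic, h3] at hG
    have h2 : v.1 2 = 0 := by simpa using hG
    exact v.2.2.elim (fun k => k h2) (fun k => k h3)
  have hv' : c 1 * v.1 0 = c 0 * v.1 1 := by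
    simpa [fibreForm, sub_eq_zero] using hv
  obtain ⟨l, hl0, hl1⟩ : ∃ l : ℂˣ, c 0 = l * v.1 0 ∧ c 1 = l * v.1 1 := by
    by_cases h0 : v.1 0 = 0
    · have h1 : v.1 1 ≠ 0 := v.2.1.resolve_left (not_not.2 h0)
      have hc0 : c 0 = 0 := by
        rw [h0, mul_zero] at hv'
        exact (mul_eq_zero.1 hv'.symm).resolve_right h1
      have hc1 : c 1 ≠ 0 := hc'.resolve_left (not_not.2 hc0)
      exact ⟨Units.mk0 (c 1 / v.1 1) (div_ne_zero hc1 h1), by simp [hc0, h0], by simp [h1]⟩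
    · have hc0 : c 0 ≠ 0 := by
        intro k
        rw [k, zero_mul] at hv'
        exact hc'.elim (fun k' => k' k) (fun k' => k' ((mul_eq_zero.1 hv').resolve_right h0))
      refine ⟨Units.mk0 (c 0 / v.1 0) (div_ne_zero hc0 h0), by simp [h0], ?_⟩
      simp only [Units.val_mk0]
      field_simp
      linear_combination hv'
  let m : ℂˣ := Units.mk0 (v.1 3)⁻¹ (inv_ne_zero h3)
  have hw : ![c 0, c 1, (l : ℂ) ^ (2 * d) * m * v.1 2, 1] = act (2 * d) l m v.1 := by
    funext i
    fin_cases i <;> simp [act, hl0, hl1, m, h3]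
  refine ⟨(l : ℂ) ^ (2 * d) * m * v.1 2, ?_, (mk_eq_mk.2 ⟨l, m, hw⟩).symm⟩
  rw [Polynomial.mem_rootSet]
  refine ⟨hQ, ?_⟩
  have hE := W.eval_cubic_act l m v.1
  rw [hG, mul_zero, ← hw, eval_cubic] at hE
  simp only [Matrix.cons_val] at hE
  simp only [Q, map_add, map_mul, map_pow, Polynomial.aeval_X, Polynomial.aeval_C,
    Algebra.algebraMap_self, RingHom.id_apply]
  linear_combination hE

/-- `𝒞` is smooth: the differential of its equation vanishes at no point of `𝒞`. -/
def IsSmooth : Prop :=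
  ∀ v : Coord, Ruled.mk (2 * d) v ∈ W.branchCurve → ∃ i, eval v.1 (pderiv i W.cubic) ≠ 0

/-- `𝒞` is irreducible (as a divisor): its equation is an irreducible polynomial. -/
class IsIrreducible : Prop where
  irreducible : Irreducible W.cubic

/-! ### Rational functions on `𝒞` -/

/-- The bigraded homogeneous coordinate ring of `𝒞`. -/
abbrev CoordRing : Type := MvPolynomial (Fin 4) ℂ ⧸ Ideal.span {W.cubic}

variable [W.IsIrreducible]

instance : IsDomain W.CoordRing := by
  have hp : Prime W.cubic := (IsIrreducible.irreducible (W := W)).prime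
  have : (Ideal.span {W.cubic}).IsPrime := (Ideal.span_singleton_prime hp.ne_zero).2 hp
  exact Ideal.Quotient.isDomain _

/-- The class of a polynomial in the fraction field of the homogeneous coordinate ring. -/
def res : MvPolynomial (Fin 4) ℂ →ₐ[ℂ] FractionRing W.CoordRing :=
  (IsScalarTower.toAlgHom ℂ W.CoordRing (FractionRing W.CoordRing)).comp
    (Ideal.Quotient.mkₐ ℂ (Ideal.span {W.cubic}))

lemma res_eq_zero_iff (A : MvPolynomial (Fin 4) ℂ) : W.res A = 0 ↔ W.cubic ∣ A := by
  have : W.res A = algebraMap W.CoordRing (FractionRing W.CoordRing)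
      (Ideal.Quotient.mk (Ideal.span {W.cubic}) A) := rfl
  rw [this, IsFractionRing.to_map_eq_zero_iff, Ideal.Quotient.eq_zero_iff_mem,
    Ideal.mem_span_singleton]

/-- The field of rational functions on `𝒞`: quotients of bihomogeneous polynomials of equal
bidegree, restricted to `𝒞`. -/
def functionField : IntermediateField ℂ (FractionRing W.CoordRing) where
  carrier := {f | ∃ (n : ℕ × ℕ) (A B : MvPolynomial (Fin 4) ℂ), IsBihom (2 * d) A n ∧
    IsBihom (2 * d) B n ∧ W.res B ≠ 0 ∧ f = W.res A / W.res B}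
  mul_mem' := by
    rintro f g ⟨n, A, B, hA, hB, h0, rfl⟩ ⟨n', A', B', hA', hB', h0', rfl⟩
    exact ⟨n + n', A * A', B * B', hA.mul hA', hB.mul hB', by simp [h0, h0'],
      by rw [map_mul, map_mul, div_mul_div_comm]⟩
  add_mem' := by
    rintro f g ⟨n, A, B, hA, hB, h0, rfl⟩ ⟨n', A', B', hA', hB', h0', rfl⟩
    exact ⟨n + n', A * B' + B * A', B * B', isBihom_add (hA.mul hB') (hB.mul hA'), hB.mul hB',
      by simp [h0, h0'], by rw [map_add, map_mul, map_mul, map_mul, div_add_div _ _ h0 h0']⟩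
  algebraMap_mem' := fun a =>
    ⟨0, C a, 1, isBihom_C _ a, isWeightedHomogeneous_one _ _, by simp, by
      rw [map_one, div_one]; exact (W.res.commutes a).symm⟩
  inv_mem' := by
    rintro f ⟨n, A, B, hA, hB, h0, rfl⟩
    by_cases hA0 : W.res A = 0
    · exact ⟨0, 0, 1, isWeightedHomogeneous_zero _ _ _, isWeightedHomogeneous_one _ _, by simp,
        by simp [hA0]⟩
    · exact ⟨n, B, A, hB, hA, hA0, by rw [inv_div]⟩

/-- The rational function `A / B` on `𝒞`. -/
def ratio (A B : MvPolynomial (Fin 4) ℂ) (n : ℕ × ℕ) (hA : IsBihom (2 * d) A n)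
    (hB : IsBihom (2 * d) B n) : W.functionField :=
  ⟨W.res A / W.res B, by
    by_cases h : W.res B = 0
    · rw [h, div_zero]; exact zero_mem _
    · exact ⟨n, A, B, hA, hB, h, rfl⟩⟩

/-- The local ring of `𝒞` at `p`: the rational functions `A / B` whose denominator does not vanish
at `p`. -/
def localRing (p : Surface (2 * d)) : Subalgebra ℂ W.functionField where
  carrier := {f | ∃ (n : ℕ × ℕ) (A B : MvPolynomial (Fin 4) ℂ), IsBihom (2 * d) A n ∧
    IsBihom (2 * d) B n ∧ W.res B ≠ 0 ∧ p ∉ zeroLocus (2 * d) B ∧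
    (f : FractionRing W.CoordRing) = W.res A / W.res B}
  mul_mem' := by
    rintro f g ⟨n, A, B, hA, hB, h0, hp, hf⟩ ⟨n', A', B', hA', hB', h0', hp', hg⟩
    refine ⟨n + n', A * A', B * B', hA.mul hA', hB.mul hB', by simp [h0, h0'], ?_,
      by push_cast; rw [hf, hg, map_mul, map_mul, div_mul_div_comm]⟩
    rintro ⟨v, hv, h⟩
    rw [map_mul] at h
    exact (mul_eq_zero.1 h).elim (fun k => hp ⟨v, hv, k⟩) (fun k => hp' ⟨v, hv, k⟩)
  add_mem' := by
    rintro f g ⟨n, A, B, hA, hB, h0, hp, hf⟩ ⟨n', A', B', hA', hB', h0', hp', hg⟩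
    refine ⟨n + n', A * B' + B * A', B * B', isBihom_add (hA.mul hB') (hB.mul hA'), hB.mul hB',
      by simp [h0, h0'], ?_, by
        push_cast; rw [hf, hg, map_add, map_mul, map_mul, map_mul, div_add_div _ _ h0 h0']⟩
    rintro ⟨v, hv, h⟩
    rw [map_mul] at h
    exact (mul_eq_zero.1 h).elim (fun k => hp ⟨v, hv, k⟩) (fun k => hp' ⟨v, hv, k⟩)
  algebraMap_mem' := fun a =>
    ⟨0, C a, 1, isBihom_C _ a, isWeightedHomogeneous_one _ _, by simp,
      by rintro ⟨v, -, h⟩; simp at h, by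
      rw [map_one, div_one]; exact (W.res.commutes a).symm⟩

/-! ### Orders, divisors, differentials -/

/-- `π` is a local parameter at `p`: its multiples are exactly the non-units of the local ring. -/
def IsUniformizer (p : Surface (2 * d)) (π : W.localRing p) : Prop :=
  ∀ f : W.localRing p, π ∣ f ↔ ¬ IsUnit f

/-- `f` has order `n` at `p`: it is a unit of the local ring times the `n`-th power of a local
parameter. -/
def HasOrd (p : Surface (2 * d)) (f : W.functionField) (n : ℤ) : Prop :=
  ∃ (π : W.localRing p) (u : (W.localRing p)ˣ), W.IsUniformizer p π ∧
    f = ((u : W.localRing p) : W.functionField) * (π : W.functionField) ^ n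

open Classical in
/-- The order of vanishing of `f` at `p`; the value `0` is used if `f` has no order (for smooth `𝒞`
only if `f = 0`). -/
def ord (p : Surface (2 * d)) (f : W.functionField) : ℤ :=
  if h : ∃ n, W.HasOrd p f n then h.choose else 0

lemma ord_unit (p : Surface (2 * d)) (u : (W.localRing p)ˣ) :
    W.ord p ((u : W.localRing p) : W.functionField) = 0 := by
  unfold ord
  split_ifs with h
  · generalize hn : h.choose = n
    have hs : W.HasOrd p ((u : W.localRing p) : W.functionField) n := hn ▸ h.choose_spec
    obtain ⟨π, u', hπ, he⟩ := hs
    have hπu : ¬ IsUnit π := (hπ π).1 dvd_rfl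
    have key : ∀ (k : ℕ) (a b : (W.localRing p)ˣ), k ≠ 0 →
        (a : W.localRing p) = (b : W.localRing p) * π ^ k → False := by
      intro k a b hk hab
      have h1 : IsUnit ((b : W.localRing p) * π ^ k) := hab ▸ a.isUnit
      exact hπu ((isUnit_pow_iff hk).1 (isUnit_of_mul_isUnit_right h1))
    rcases Int.eq_nat_or_neg n with ⟨k, rfl | rfl⟩
    · by_contra hk
      refine key k u u' (by rintro rfl; exact hk rfl) ?_
      apply Subtype.ext
      rw [he]; push_cast; rw [zpow_natCast]
    · by_contra hk
      refine key k u' u (by rintro rfl; exact hk rfl) ?_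
      have hu : ((u : W.localRing p) : W.functionField) ≠ 0 := by
        intro h0
        exact u.ne_zero (Subtype.ext h0)
      have hπ0 : (π : W.functionField) ≠ 0 := by
        intro h0
        rw [h0, zero_zpow _ hk, mul_zero] at he
        exact hu he
      apply Subtype.ext
      push_cast
      rw [he, zpow_neg, zpow_natCast, mul_assoc, inv_mul_cancel₀ (pow_ne_zero _ hπ0), mul_one]
  · rfl

/-- Divisors on `𝒞`. -/
abbrev Divisor : Type := W.branchCurve →₀ ℤ

/-- Linear equivalence: the difference of the two divisors is the divisor of a rational function. -/
def LinEquiv (D D' : W.Divisor) : Prop :=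
  ∃ f : W.functionField, f ≠ 0 ∧ ∀ p : W.branchCurve, W.HasOrd p f (D p - D' p)

/-- The space `H⁰(𝒞, O(D))` of global sections. Near `p` the sheaf `O(D)` is generated by `g⁻¹`,
for any local equation `g` of `D` at `p`. -/
def H0 (D : W.Divisor) : Submodule ℂ W.functionField where
  carrier := {f | ∀ (p : W.branchCurve) (g : W.functionField), W.HasOrd p g (D p) →
    f * g ∈ W.localRing p}
  add_mem' := fun hf hg p k hk => by rw [add_mul]; exact add_mem (hf p k hk) (hg p k hk)
  zero_mem' := fun p k _ => by rw [zero_mul]; exact zero_mem _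
  smul_mem' := fun a f hf p k hk => by
    rw [smul_mul_assoc]; exact Subalgebra.smul_mem _ (hf p k hk) a

/-- The dimension `h⁰(𝒞, D)`. -/
def h0 (D : W.Divisor) : ℕ := Module.finrank ℂ (W.H0 D)

/-- `D` is a canonical divisor: the divisor of a nonzero rational differential form `ω`, where
the order of `f dπ` at `p` is that of `f` if `π` is a local parameter. -/
def IsCanonical (D : W.Divisor) : Prop :=
  ∃ ω : Ω[W.functionField⁄ℂ], ω ≠ 0 ∧ ∀ p : W.branchCurve,
    ∃ (π : W.localRing p) (f : W.functionField), W.IsUniformizer p π ∧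
      ω = f • KaehlerDifferential.D ℂ W.functionField π ∧ W.HasOrd p f (D p)

/-- The space of regular differential forms on `𝒞`. -/
def regularForms : Submodule ℂ Ω[W.functionField⁄ℂ] where
  carrier := {ω | ∀ (p : W.branchCurve) (π : W.localRing p), W.IsUniformizer p π →
    ∃ f : W.localRing p, ω = (f : W.functionField) • KaehlerDifferential.D ℂ W.functionField π}
  add_mem' := fun ha hb p π hπ => by
    obtain ⟨f, rfl⟩ := ha p π hπ
    obtain ⟨g, hg⟩ := hb p π hπ
    exact ⟨f + g, by rw [hg, ← add_smul]; rfl⟩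
  zero_mem' := fun p π _ => ⟨0, by simp⟩
  smul_mem' := fun a ω h p π hπ => by
    obtain ⟨f, rfl⟩ := h p π hπ
    exact ⟨a • f, by rw [Subalgebra.coe_smul, smul_assoc]⟩

/-- The genus of `𝒞`. -/
def genus : ℕ := Module.finrank ℂ W.regularForms

/-- A theta characteristic is (the class of) a divisor `D` such that `2 D` is linearly equivalent to
a canonical divisor. -/
def IsThetaCharacteristic (D : W.Divisor) : Prop :=
  ∃ K : W.Divisor, W.IsCanonical K ∧ W.LinEquiv ((2 : ℤ) • D) K

/-! ### The restriction of a fibre to `𝒞` -/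

open Classical in
/-- A linear form in `s, t` that does not vanish at `p`. -/
def denom (p : Surface (2 * d)) : MvPolynomial (Fin 4) ℂ :=
  if p ∈ zeroLocus (2 * d) (X 0) then X 1 else X 0

lemma isBihom_denom (p : Surface (2 * d)) : IsBihom (2 * d) (denom p) (1, 0) := by
  unfold denom
  split_ifs
  · exact isBihom_X1 _
  · exact isBihom_X0 _

lemma notMem_zeroLocus_denom (p : Surface (2 * d)) : p ∉ zeroLocus (2 * d) (denom p) := by
  unfold denom
  split_ifs with h
  · obtain ⟨v, rfl, hv⟩ := h
    rintro ⟨w, hw, hw1⟩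
    obtain ⟨l, m, h⟩ := mk_eq_mk.1 hw
    rw [eval_X] at hv hw1
    refine v.2.1.elim (fun k => k hv) (fun k => k ?_)
    rw [h]
    simp [act, hw1]
  · exact h

/-- The local equation at `p` of the fibre of `F_{2d}` over `c`, restricted to `𝒞`. -/
def fibreEquation (c : Fin 2 → ℂ) (p : Surface (2 * d)) : W.functionField :=
  W.ratio (fibreForm c) (denom p) (1, 0) (isBihom_fibreForm _ c) (isBihom_denom p)

lemma res_ne_zero {A : MvPolynomial (Fin 4) ℂ} {p : Surface (2 * d)} (hp : p ∈ W.branchCurve)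
    (h : p ∉ zeroLocus (2 * d) A) : W.res A ≠ 0 := by
  intro h0
  obtain ⟨B, rfl⟩ := (W.res_eq_zero_iff A).1 h0
  obtain ⟨v, rfl⟩ : ∃ v, Ruled.mk (2 * d) v = p := Quotient.exists_rep p
  refine h ⟨v, rfl, ?_⟩
  rw [map_mul, (W.mk_mem_branchCurve v).1 hp, zero_mul]

lemma ord_fibreEquation_eq_zero (c : Fin 2 → ℂ) (p : Surface (2 * d)) (hp : p ∈ W.branchCurve)
    (h : p ∉ zeroLocus (2 * d) (fibreForm c)) : W.ord p (W.fibreEquation c p) = 0 := by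
  have hA := W.res_ne_zero hp h
  have hB := W.res_ne_zero hp (notMem_zeroLocus_denom p)
  let f : W.localRing p := ⟨W.fibreEquation c p, (1, 0), fibreForm c, denom p,
    isBihom_fibreForm _ c, isBihom_denom p, hB, notMem_zeroLocus_denom p, rfl⟩
  let g : W.localRing p := ⟨W.ratio (denom p) (fibreForm c) (1, 0) (isBihom_denom p)
    (isBihom_fibreForm _ c), (1, 0), denom p, fibreForm c,
    isBihom_denom p, isBihom_fibreForm _ c, hA, h, rfl⟩
  have hfg : f * g = 1 := by
    apply Subtype.ext
    apply Subtype.ext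
    change W.res (fibreForm c) / W.res (denom p) * (W.res (denom p) / W.res (fibreForm c)) = 1
    field_simp
  exact W.ord_unit p ⟨f, g, hfg, by rw [mul_comm, hfg]⟩

/-- The restriction `F|_𝒞` to `𝒞` of the fibre `F` of `F_{2d}` over the point `c` of the projective
line: its multiplicity at `p` is the order at `p` of the local equation of `F`. -/
def fibreDivisor (c : Fin 2 → ℂ) (hc : c ≠ 0) : W.Divisor :=
  Finsupp.ofSupportFinite (fun p => W.ord p (W.fibreEquation c p)) (by
    refine Set.Finite.of_finite_image (f := Subtype.val) ((W.finite_fibre c hc).subset ?_)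
      Subtype.val_injective.injOn
    rintro _ ⟨p, hp, rfl⟩
    refine ⟨p.2, ?_⟩
    by_contra h
    exact hp (W.ord_fibreEquation_eq_zero c p p.2 h))

end WeierstrassModel

end

/-!
Let `u` and `x` be the base and fibre coordinates on an affine chart, and let `G` be the equation of
`𝒞` there, a monic cubic in `x`. Regular functions on the chart have a unique expansion
`a₀(u) + a₁(u) x + a₂(u) x²`. After trivializing the multiple `kF` of a fibre `F` by the `k`-th
power of a base coordinate, a section of it over `𝒞` has such an expansion on both charts, and
comparing the two shows that the sections are exactly the expansions with `deg aⱼ ≤ k - 2dj`. The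
residue form `du / ∂ₓG` has neither zeros nor poles on its chart, and its divisor on `𝒞` is
`(4d - 2)F`. Hence `(4d - 2)F` is canonical, so `(2d - 1)F` is a theta characteristic, the
genus is `(4d - 1) + (2d - 1)`, and the sections of `(2d - 1)F` are the `a₀(u)` of degree less than
`2d`.
-/

open Ruled

noncomputable section

lemma exists_eq_C_eval_add_sum {σ R : Type*} [Fintype σ] [CommRing R]
    (w : σ → R) (a : MvPolynomial σ R) : ∃ α : σ → MvPolynomial σ R,
      a = C (eval w a) + ∑ j, (X j - C (w j)) * α j ∧ ∀ j, eval w (α j) = eval w (pderiv j a) := by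
  classical
  suffices h : ∃ α : σ → MvPolynomial σ R, a = C (eval w a) + ∑ j, (X j - C (w j)) * α j by
    obtain ⟨α, hα⟩ := h
    refine ⟨α, hα, fun j => ?_⟩
    rw [hα]
    simp [pderiv_X, Pi.single_apply, Finset.sum_add_distrib]
  induction a using MvPolynomial.induction_on with
  | C r => exact ⟨0, by simp⟩
  | add p q hp hq =>
    obtain ⟨α, hα⟩ := hp
    obtain ⟨β, hβ⟩ := hq
    refine ⟨α + β, ?_⟩
    conv_lhs => rw [hα, hβ]
    simp only [map_add, Pi.add_apply, mul_add, Finset.sum_add_distrib]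
    ring
  | mul_X p i hp =>
    obtain ⟨α, hα⟩ := hp
    refine ⟨fun j => C (w i) * α j + (Pi.single i p : σ → MvPolynomial σ R) j, ?_⟩
    have hsum : ∑ j, (X j - C (w j)) * (Pi.single i p : σ → MvPolynomial σ R) j =
        (X i - C (w i)) * p := by simp [Pi.single_apply]
    simp only [mul_add, Finset.sum_add_distrib, hsum, mul_left_comm _ (C (w i)), ← Finset.mul_sum]
    rw [map_mul, eval_X, map_mul]
    linear_combination C (w i) * hα

open Polynomial in
lemma aeval_inv_mul_pow_natDegree {k K : Type*} [CommSemiring k] [Field K] [Algebra k K] {u : K}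
    (hu : u ≠ 0) (Q : k[X]) : aeval u⁻¹ Q * u ^ Q.natDegree = aeval u Q.reverse := by
  let _ : Invertible u⁻¹ := invertibleOfNonzero (inv_ne_zero hu)
  have key := eval₂_reverse_mul_pow (algebraMap k K) u⁻¹ Q
  rw [invOf_eq_inv, inv_inv] at key
  rw [Polynomial.aeval_def, ← key, ← Polynomial.aeval_def, mul_assoc, ← mul_pow,
    inv_mul_cancel₀ hu, one_pow, mul_one]

open Polynomial in
lemma natDegree_add_le_of_transcendental {k K : Type*} [CommRing k] [IsDomain k] [Field K]
    [Algebra k K] {u : K} (hu : Transcendental k u) {P Q : k[X]} (hP : P ≠ 0)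
    {a b : ℕ} (h : aeval u P * u ^ a = aeval u⁻¹ Q * u ^ b) : P.natDegree + a ≤ b := by
  have hu0 : u ≠ 0 := by
    rintro rfl
    exact hu isAlgebraic_zero
  have key : P * Polynomial.X ^ (a + Q.natDegree) = Q.reverse * Polynomial.X ^ b := by
    refine transcendental_iff_injective.1 hu ?_
    simp only [map_mul, map_pow, Polynomial.aeval_X, pow_add, ← aeval_inv_mul_pow_natDegree hu0]
    linear_combination u ^ Q.natDegree * h
  have hQ0 : Q.reverse ≠ 0 := by
    intro h0
    rw [h0, zero_mul] at key
    exact mul_ne_zero hP (pow_ne_zero _ Polynomial.X_ne_zero) key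
  have hdeg := congrArg natDegree key
  rw [natDegree_mul_X_pow _ hP, natDegree_mul_X_pow _ hQ0] at hdeg
  have := reverse_natDegree_le Q
  omega

open Polynomial in
lemma aeval_eq_of_sum_eq_sum_aeval_inv {k K ι : Type*} [CommRing k] [Field K] [Algebra k K]
    [Fintype ι] {u : K} (hu : u ≠ 0) {y : ι → K}
    (hy : Function.Injective fun a : ι → k[X] => ∑ j, aeval u (a j) * y j) {P Q : ι → k[X]}
    {n : ℕ} (h : ∑ j, aeval u (P j) * y j = (∑ j, aeval u⁻¹ (Q j) * y j) * u ^ n) (j : ι) :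
    aeval u (P j) = aeval u⁻¹ (Q j) * u ^ n := by
  let N : ℕ := ∑ j, (Q j).natDegree
  let R : ι → k[X] := fun j => (Q j).reverse * Polynomial.X ^ (N - (Q j).natDegree)
  have hR (j : ι) : aeval u (R j) = aeval u⁻¹ (Q j) * u ^ N := by
    have hN : (Q j).natDegree ≤ N :=
      Finset.single_le_sum (f := fun j => (Q j).natDegree) (fun _ _ => Nat.zero_le _)
        (Finset.mem_univ j)
    rw [map_mul, ← aeval_inv_mul_pow_natDegree hu, map_pow, Polynomial.aeval_X, mul_assoc,
      ← pow_add, Nat.add_sub_cancel' hN]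
  have key : (fun j => P j * Polynomial.X ^ N) = fun j => R j * Polynomial.X ^ n := by
    apply hy
    simp only [map_mul, map_pow, Polynomial.aeval_X, hR, mul_right_comm _ (u ^ _) (y _),
      ← Finset.sum_mul, h, mul_right_comm _ (u ^ n)]
  have hj := congrArg (Polynomial.aeval u) (congrFun key j)
  simp only [map_mul, map_pow, Polynomial.aeval_X, hR] at hj
  exact mul_right_cancel₀ (pow_ne_zero N hu) (hj.trans (mul_right_comm ..))

lemma isNoetherianRing_of_forall_associated {A R : Type*} [CommRing A] [CommRing R]
    [IsNoetherianRing A] (φ : A →+* R) (h : ∀ r, ∃ a, Associated (φ a) r) :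
    IsNoetherianRing R := by
  have hI (I : Ideal R) : (I.comap φ).map φ = I := by
    refine le_antisymm Ideal.map_comap_le fun r hr => ?_
    obtain ⟨a, ha⟩ := h r
    exact Ideal.mem_of_dvd _ ha.dvd
      (Ideal.mem_map_of_mem φ (Ideal.mem_comap.2 (I.mem_of_dvd ha.dvd' hr)))
  rw [isNoetherianRing_iff_ideal_fg]
  intro I
  rw [← hI I]
  exact Ideal.FG.map (IsNoetherian.noetherian _) φ

lemma exists_unit_mul_pow_of_dvd_iff {R : Type*} [CommRing R] [IsDomain R] [IsNoetherianRing R]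
    {π a : R} (hπ : ∀ f, π ∣ f ↔ ¬ IsUnit f) (ha : a ≠ 0) : ∃ (n : ℕ) (v : Rˣ), a = v * π ^ n := by
  obtain ⟨b, hb, hπb⟩ := (FiniteMultiplicity.of_not_isUnit ((hπ π).1 dvd_rfl)
    ha).exists_eq_pow_mul_and_not_dvd
  rw [hπ, not_not] at hπb
  exact ⟨_, hπb.unit, by rw [mul_comm, hπb.unit_spec, ← hb]⟩

lemma finrank_eq_of_forall_mem_iff {k V V' : Type*} [Ring k] [AddCommGroup V] [Module k V]
    [AddCommGroup V'] [Module k V'] (e : V ≃ₗ[k] V') {A : Submodule k V} {B : Submodule k V'}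
    (h : ∀ x, x ∈ A ↔ e x ∈ B) : Module.finrank k A = Module.finrank k B := by
  obtain rfl : A = B.comap e.toLinearMap := Submodule.ext h
  exact (e.ofSubmodule' B).finrank_eq

open KaehlerDifferential in
lemma exists_basis_D_of_isTranscendenceBasis {k K ι : Type*} [Field k] [CharZero k] [Field K]
    [Algebra k K] {x : ι → K} (hx : IsTranscendenceBasis k x) :
    ∃ b : Module.Basis ι K Ω[K⁄k], ∀ i, b i = D k K (x i) := by
  let _ : Algebra (MvPolynomial ι k) K := (aeval x).toAlgebra
  have hX (i : ι) : algebraMap (MvPolynomial ι k) K (X i) = x i := aeval_X x i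
  have : IsScalarTower k (MvPolynomial ι k) K := .of_algebraMap_eq' (aeval x).comp_algebraMap.symm
  have : FaithfulSMul (MvPolynomial ι k) K :=
    (faithfulSMul_iff_algebraMap_injective _ _).2 hx.1
  let _ := FractionRing.liftAlgebra (MvPolynomial ι k) K
  have : CharZero (FractionRing (MvPolynomial ι k)) :=
    charZero_of_injective_algebraMap (algebraMap k (FractionRing (MvPolynomial ι k))).injective
  have : Algebra.IsAlgebraic (MvPolynomial ι k) K :=
    have := hx.isAlgebraic
    .of_ringHom_of_comp_eq hx.1.aevalEquiv (RingHom.id K) (AlgEquiv.surjective _)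
      Function.injective_id (RingHom.ext fun p => hx.1.algebraMap_aevalEquiv p)
  have : Algebra.IsAlgebraic (FractionRing (MvPolynomial ι k)) K :=
    (IsFractionRing.comap_isAlgebraic_iff (A := MvPolynomial ι k)).1 this
  have : Algebra.FormallyEtale (MvPolynomial ι k) (FractionRing (MvPolynomial ι k)) :=
    .of_isLocalization (nonZeroDivisors _)
  have : Algebra.FormallyEtale (FractionRing (MvPolynomial ι k)) K := .of_isSeparable _ _
  have : Algebra.FormallyEtale (MvPolynomial ι k) K :=
    .comp _ (FractionRing (MvPolynomial ι k)) _
  refine ⟨((mvPolynomialBasis k ι).baseChange K).map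
    (tensorKaehlerEquivOfFormallyEtale k (MvPolynomial ι k) K), fun i => ?_⟩
  rw [Module.Basis.map_apply, Module.Basis.baseChange_apply, mvPolynomialBasis_apply]
  simp [hX]

open KaehlerDifferential in
lemma D_ne_zero_of_transcendental {k K : Type*} [Field k] [CharZero k] [Field K] [Algebra k K]
    {x : K} (hx : Transcendental k x) : D k K x ≠ 0 := by
  have hind : AlgebraicIndepOn k id {x} := algebraicIndependent_unique_type_iff.2 hx
  obtain ⟨t, hxt, ht⟩ := exists_isTranscendenceBasis_superset hind
  obtain ⟨b, hb⟩ := exists_basis_D_of_isTranscendenceBasis ht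
  exact hb ⟨x, hxt rfl⟩ ▸ b.ne_zero _

lemma derivation_aeval {k A M σ : Type*} [CommSemiring k] [CommSemiring A] [Algebra k A]
    [AddCommMonoid M] [Module k M] [Module A M] [Fintype σ] (D : Derivation k A M)
    (x : σ → A) (p : MvPolynomial σ k) : D (aeval x p) = ∑ i, aeval x (pderiv i p) • D (x i) := by
  classical
  induction p using MvPolynomial.induction_on with
  | C a => simp
  | add p q hp hq => simp only [map_add, hp, hq, add_smul, Finset.sum_add_distrib]
  | mul_X p j hp =>
    simp [hp, pderiv_X, Pi.single_apply, add_smul, Finset.sum_add_distrib, Finset.smul_sum,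
      mul_smul, ite_smul, apply_ite (aeval x)]

lemma smul_add_smul_eq_of_smul_add_smul_eq_zero {K V : Type*} [Field K] [AddCommGroup V]
    [Module K V] {x y : K} {U Z : V} (hy : y ≠ 0) (h : x • U + y • Z = 0) (a b : K) :
    a • U + b • Z = (y * a - x * b) • (y⁻¹ • U) := by
  have hZ : Z = -(y⁻¹ * x) • U := by
    rw [neg_smul, mul_smul, ← smul_neg, eq_inv_smul_iff₀ hy, eq_neg_iff_add_eq_zero, add_comm, h]
  rw [hZ, smul_smul, smul_smul, ← add_smul]
  congr 1
  field_simp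
  ring

lemma exists_unit_mul_add_mul_eq {R : Type*} [CommRing R] {π : R}
    (hπ : ∀ r, π ∣ r ↔ ¬ IsUnit r) (u v : Rˣ) (s : R) : ∃ w : Rˣ, (w : R) = u * v + π * s := by
  by_contra! h
  have hn : ¬ IsUnit (u * v + π * s : R) := fun ⟨w, hw⟩ => h w hw
  exact (hπ _).1 ((dvd_add_left (dvd_mul_right π s)).1 ((hπ _).2 hn)) (u * v).isUnit

/-! ### Affine charts -/

namespace Ruled

/-- The index of the base coordinate which is nonzero on the `i`-th chart. -/
def baseIdx (i : Fin 2) : Fin 4 := ![0, 1] i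

/-- The indices of the base coordinate and of the fibre coordinate of the `i`-th chart. -/
def affineIdx (i : Fin 2) : Fin 2 → Fin 4 := ![![1, 2], ![0, 2]] i

/-- The coordinate vector of the point of the `i`-th chart with affine coordinates `w`. -/
def chartVec {R : Type*} [CommSemiring R] (i : Fin 2) (w : Fin 2 → R) : Fin 4 → R :=
  ![![1, w 0, w 1, 1], ![w 0, 1, w 1, 1]] i

/-- Dehomogenization on the `i`-th chart. -/
def dehom (i : Fin 2) : MvPolynomial (Fin 4) ℂ →ₐ[ℂ] MvPolynomial (Fin 2) ℂ :=
  aeval (chartVec i X)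

@[simp] lemma dehom_C (i : Fin 2) (a : ℂ) : dehom i (C a) = C a := by simp [dehom]

@[simp] lemma dehom_X_baseIdx (i : Fin 2) : dehom i (X (baseIdx i)) = 1 := by
  fin_cases i <;> simp [dehom, baseIdx, chartVec]

@[simp] lemma dehom_X_affineIdx (i j : Fin 2) : dehom i (X (affineIdx i j)) = X j := by
  fin_cases i <;> fin_cases j <;> simp [dehom, affineIdx, chartVec]

@[simp] lemma dehom_zero_X0 : dehom 0 (X 0) = 1 := dehom_X_baseIdx 0

@[simp] lemma dehom_zero_X1 : dehom 0 (X 1) = X 0 := dehom_X_affineIdx 0 0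

@[simp] lemma dehom_one_X0 : dehom 1 (X 0) = X 0 := dehom_X_affineIdx 1 0

@[simp] lemma dehom_one_X1 : dehom 1 (X 1) = 1 := dehom_X_baseIdx 1

@[simp] lemma dehom_X2 (i : Fin 2) : dehom i (X 2) = X 1 := by
  fin_cases i <;> simp [dehom, chartVec]

@[simp] lemma dehom_X3 (i : Fin 2) : dehom i (X 3) = 1 := by
  fin_cases i <;> simp [dehom, chartVec]

lemma aeval_dehom {R : Type*} [CommRing R] [Algebra ℂ R] (i : Fin 2) (w : Fin 2 → R)
    (A : MvPolynomial (Fin 4) ℂ) : aeval w (dehom i A) = aeval (chartVec i w) A := by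
  rw [dehom, ← AlgHom.comp_apply, comp_aeval]
  congr 2
  funext j
  fin_cases i <;> fin_cases j <;> simp [chartVec]

lemma pderiv_dehom (i j : Fin 2) (A : MvPolynomial (Fin 4) ℂ) :
    pderiv j (dehom i A) = dehom i (pderiv (affineIdx i j) A) := by
  induction A using MvPolynomial.induction_on with
  | C a => simp
  | add p q hp hq => simp [hp, hq]
  | mul_X p k hp =>
    rw [map_mul, Derivation.leibniz, Derivation.leibniz, hp]
    fin_cases i <;> fin_cases j <;> fin_cases k <;> simp [dehom, chartVec, affineIdx, pderiv_X]

lemma isBihom_X_baseIdx (e : ℕ) (i : Fin 2) : IsBihom e (X (baseIdx i)) (1, 0) := by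
  fin_cases i
  exacts [isBihom_X0 e, isBihom_X1 e]

lemma isBihom_X_affineIdx_zero (e : ℕ) (i : Fin 2) : IsBihom e (X (affineIdx i 0)) (1, 0) := by
  fin_cases i
  exacts [isBihom_X1 e, isBihom_X0 e]

lemma isBihom_X2 (e : ℕ) : IsBihom e (X 2) (e, 1) := isWeightedHomogeneous_X ℂ (weight e) 2

lemma isBihom_X3 (e : ℕ) : IsBihom e (X 3) (0, 1) := isWeightedHomogeneous_X ℂ (weight e) 3

lemma isBihom_X_baseIdx_pow_mul_X3_pow (e : ℕ) (i : Fin 2) (n : ℕ × ℕ) :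
    IsBihom e (X (baseIdx i) ^ n.1 * X 3 ^ n.2) n := by
  simpa using ((isBihom_X_baseIdx e i).pow n.1).mul ((isBihom_X3 e).pow n.2)

lemma weight_apply_fin_four (e : ℕ) (k : Fin 4 →₀ ℕ) :
    Finsupp.weight (weight e) k = (k 0 + k 1 + k 2 * e, k 2 + k 3) := by
  rw [Finsupp.weight_apply, Finsupp.sum_fintype _ _ (by simp), Fin.sum_univ_four]
  simp [weight]

lemma IsBihom.aeval_smul {R : Type*} [CommRing R] [Algebra ℂ R] {e : ℕ}
    {A : MvPolynomial (Fin 4) ℂ} {n : ℕ × ℕ} (hA : IsBihom e A n) (l m : R) (v : Fin 4 → R) :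
    aeval ![l * v 0, l * v 1, l ^ e * m * v 2, m * v 3] A = l ^ n.1 * m ^ n.2 * aeval v A := by
  induction hA using IsWeightedHomogeneous.induction_on with
  | zero => simp
  | add p q hp hq h1 h2 => rw [map_add, h1, h2, map_add, mul_add]
  | monomial k r hk =>
    rw [weight_apply_fin_four] at hk
    obtain rfl := hk
    simp only [aeval_monomial, Finsupp.prod_fintype _ _ (fun _ => pow_zero _), Fin.prod_univ_four,
      Matrix.cons_val]
    ring

/-- The affine coordinates on the `i`-th chart of the point with homogeneous coordinates `v`. -/
def affineCoord {F : Type*} [Field F] (e : ℕ) (i : Fin 2) (v : Fin 4 → F) : Fin 2 → F :=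
  ![v (affineIdx i 0) / v (baseIdx i), v 2 / (v (baseIdx i) ^ e * v 3)]

lemma smul_chartVec_affineCoord {F : Type*} [Field F] {e : ℕ} {i : Fin 2} {v : Fin 4 → F}
    (hs : v (baseIdx i) ≠ 0) (hz : v 3 ≠ 0) :
    ![v (baseIdx i) * chartVec i (affineCoord e i v) 0,
      v (baseIdx i) * chartVec i (affineCoord e i v) 1,
      v (baseIdx i) ^ e * v 3 * chartVec i (affineCoord e i v) 2,
      v 3 * chartVec i (affineCoord e i v) 3] = v := by
  funext j
  fin_cases i <;> fin_cases j <;>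
    simp_all [chartVec, affineCoord, baseIdx, affineIdx, mul_div_cancel₀]

lemma IsBihom.aeval_eq {F : Type*} [Field F] [Algebra ℂ F] {e : ℕ} {i : Fin 2}
    {A : MvPolynomial (Fin 4) ℂ} {n : ℕ × ℕ} (hA : IsBihom e A n) {v : Fin 4 → F}
    (hs : v (baseIdx i) ≠ 0) (hz : v 3 ≠ 0) :
    aeval v A = v (baseIdx i) ^ n.1 * v 3 ^ n.2 * aeval (affineCoord e i v) (dehom i A) := by
  rw [aeval_dehom, ← hA.aeval_smul, smul_chartVec_affineCoord hs hz]

lemma IsBihom.eval_act {e : ℕ} {A : MvPolynomial (Fin 4) ℂ} {n : ℕ × ℕ} (hA : IsBihom e A n)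
    (l m : ℂˣ) (v : Fin 4 → ℂ) :
    eval (act e l m v) A = (l : ℂ) ^ n.1 * (m : ℂ) ^ n.2 * eval v A :=
  hA.aeval_smul (l : ℂ) (m : ℂ) v

lemma IsBihom.mk_mem_zeroLocus_iff {e : ℕ} {A : MvPolynomial (Fin 4) ℂ} {n : ℕ × ℕ}
    (hA : IsBihom e A n) (v : Coord) : Ruled.mk e v ∈ zeroLocus e A ↔ eval v.1 A = 0 := by
  refine ⟨?_, fun h => ⟨v, rfl, h⟩⟩
  rintro ⟨w, hw, h0⟩
  obtain ⟨l, m, h⟩ := mk_eq_mk.1 hw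
  rw [h, hA.eval_act, h0, mul_zero]

lemma exists_isBihom_dehom_eq (e : ℕ) (i : Fin 2) (P : MvPolynomial (Fin 2) ℂ) :
    ∃ (n : ℕ × ℕ) (A : MvPolynomial (Fin 4) ℂ), IsBihom e A n ∧ dehom i A = P := by
  induction P using MvPolynomial.induction_on with
  | C a => exact ⟨0, C a, isBihom_C e a, dehom_C i a⟩
  | add p q hp hq =>
    obtain ⟨n, A, hA, rfl⟩ := hp
    obtain ⟨m, B, hB, rfl⟩ := hq
    have key := isBihom_X_baseIdx_pow_mul_X3_pow e i
    refine ⟨n + m, A * (X (baseIdx i) ^ m.1 * X 3 ^ m.2) + B * (X (baseIdx i) ^ n.1 * X 3 ^ n.2),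
      isBihom_add (hA.mul (key m)) (by rw [add_comm n]; exact hB.mul (key n)), by simp⟩
  | mul_X p j hp =>
    obtain ⟨n, A, hA, rfl⟩ := hp
    exact ⟨_, A * X (affineIdx i j), hA.mul (isWeightedHomogeneous_X ℂ _ _), by simp⟩

/-- `chartVec i w` as admissible homogeneous coordinates of a point of the surface. -/
def chartCoord (i : Fin 2) (w : Fin 2 → ℂ) : Coord :=
  ⟨chartVec i w, by fin_cases i <;> simp [chartVec]⟩

lemma eval_chartCoord (i : Fin 2) (w : Fin 2 → ℂ) (A : MvPolynomial (Fin 4) ℂ) :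
    eval (chartCoord i w).1 A = eval w (dehom i A) :=
  (aeval_dehom i w A).symm

lemma mk_chartCoord_affineCoord {e : ℕ} {i : Fin 2} {v : Coord} (hs : v.1 (baseIdx i) ≠ 0)
    (hz : v.1 3 ≠ 0) : Ruled.mk e (chartCoord i (affineCoord e i v.1)) = Ruled.mk e v :=
  mk_eq_mk.2 ⟨Units.mk0 _ hs, Units.mk0 _ hz, (smul_chartVec_affineCoord hs hz).symm⟩

end Ruled

namespace WeierstrassModel

open Polynomial.Bivariate (equivMvPolynomial)

lemma isBihom_lift (e : ℕ) {a : MvPolynomial (Fin 2) ℂ} {n : ℕ} (ha : a.IsHomogeneous n) :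
    IsBihom e (lift a) (n, 0) := by
  have ha' : a.IsWeightedHomogeneous 1 n := ha
  induction ha' using IsWeightedHomogeneous.induction_on with
  | zero => simpa [lift] using isWeightedHomogeneous_zero ℂ (weight e) (n, 0)
  | add p q hp hq h1 h2 =>
    rw [lift, map_add]
    exact isBihom_add (h1 hp) (h2 hq)
  | monomial k r hk =>
    rw [lift, rename_monomial]
    refine isWeightedHomogeneous_monomial _ _ _ ?_
    rw [← hk, Finsupp.weight_apply, Finsupp.weight_apply, Finsupp.sum_mapDomain_index
      (h := fun i c => c • weight e i) (fun _ => zero_smul ..) (fun _ _ _ => add_smul ..),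
      Finsupp.sum_fintype _ _ (by simp), Finsupp.sum_fintype _ _ (by simp)]
    ext <;> simp [weight]

variable {d : ℕ} (W : WeierstrassModel d)

lemma isBihom_cubic : IsBihom (2 * d) W.cubic (6 * d, 3) := by
  have h₂ := (isBihom_lift (2 * d) W.hom₂).mul ((isBihom_X2 (2 * d)).pow 2)
  refine isBihom_add (isBihom_add (isBihom_add ?_ ?_) ?_) ?_
  · convert (isBihom_X2 (2 * d)).pow 3 using 1
    exact Prod.ext (by simp; ring) (by simp)
  · convert h₂.mul (isBihom_X3 (2 * d)) using 1
    exact Prod.ext (by simp; ring) (by simp)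
  · convert ((isBihom_lift (2 * d) W.hom₄).mul (isBihom_X2 (2 * d))).mul
      ((isBihom_X3 (2 * d)).pow 2) using 1
    exact Prod.ext (by simp; ring) (by simp)
  · convert (isBihom_lift (2 * d) W.hom₆).mul ((isBihom_X3 (2 * d)).pow 3) using 1
    ext <;> simp

/-- Dehomogenization of binary forms, in the base coordinate of the `i`-th chart. -/
def dehomBinary (i : Fin 2) : MvPolynomial (Fin 2) ℂ →ₐ[ℂ] Polynomial ℂ :=
  aeval (![![1, Polynomial.X], ![Polynomial.X, 1]] i)

lemma dehom_lift (i : Fin 2) (a : MvPolynomial (Fin 2) ℂ) :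
    dehom i (lift a) = equivMvPolynomial ℂ (Polynomial.C (dehomBinary i a)) := by
  let φ := (equivMvPolynomial ℂ).toAlgHom.comp (Polynomial.CAlgHom.comp (dehomBinary i))
  suffices h : (dehom i).comp (rename ![0, 1]) = φ from DFunLike.congr_fun h a
  ext j
  fin_cases i <;> fin_cases j <;> simp [φ, dehom, dehomBinary, chartVec]

/-- The equation of `𝒞` on the `i`-th chart, as a polynomial in the fibre coordinate over the
polynomials in the base coordinate. -/
def bivariateCubic (i : Fin 2) : Polynomial (Polynomial ℂ) :=
  Polynomial.X ^ 3 + (Polynomial.C (dehomBinary i W.a₂) * Polynomial.X ^ 2 +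
    Polynomial.C (dehomBinary i W.a₄) * Polynomial.X + Polynomial.C (dehomBinary i W.a₆))

lemma monic_bivariateCubic (i : Fin 2) : (W.bivariateCubic i).Monic :=
  Polynomial.monic_X_pow_add (by compute_degree!)

lemma degree_bivariateCubic (i : Fin 2) : (W.bivariateCubic i).degree = 3 := by
  rw [bivariateCubic]
  compute_degree!

lemma dehom_cubic (i : Fin 2) : dehom i W.cubic = equivMvPolynomial ℂ (W.bivariateCubic i) := by
  simp [cubic, bivariateCubic, dehom_lift, add_assoc]

/-- The point of the `i`-th chart with affine coordinates `w`. -/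
def chartPoint (d : ℕ) (i : Fin 2) (w : Fin 2 → ℂ) : Surface (2 * d) :=
  Ruled.mk (2 * d) (chartCoord i w)

lemma chartPoint_mem_branchCurve (i : Fin 2) (w : Fin 2 → ℂ) :
    chartPoint d i w ∈ W.branchCurve ↔ eval w (dehom i W.cubic) = 0 := by
  rw [chartPoint, mk_mem_branchCurve, eval_chartCoord]

variable [W.IsIrreducible]

lemma res_ne_zero_of_degree_lt {i : Fin 2} {A : MvPolynomial (Fin 4) ℂ}
    {Q : Polynomial (Polynomial ℂ)} (hA : dehom i A = equivMvPolynomial ℂ Q) (hQ : Q ≠ 0)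
    (hdeg : Q.degree < 3) : W.res A ≠ 0 := by
  intro h
  refine hQ (Polynomial.eq_zero_of_dvd_of_degree_lt (p := W.bivariateCubic i) ?_
    (by rwa [degree_bivariateCubic]))
  rw [← map_dvd_iff (equivMvPolynomial ℂ), ← hA, ← dehom_cubic]
  exact map_dvd _ ((W.res_eq_zero_iff A).1 h)

lemma res_X_baseIdx_ne_zero (i : Fin 2) : W.res (X (baseIdx i)) ≠ 0 :=
  W.res_ne_zero_of_degree_lt (i := i) (Q := 1) (by simp) one_ne_zero (by simp)

lemma res_X3_ne_zero : W.res (X 3) ≠ 0 :=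
  W.res_ne_zero_of_degree_lt (i := 0) (Q := 1) (by simp) one_ne_zero (by simp)

/-- The affine coordinates of the `i`-th chart, as rational functions on `𝒞`. -/
def affineFn (i : Fin 2) : Fin 2 → W.functionField :=
  ![W.ratio (X (affineIdx i 0)) (X (baseIdx i)) (1, 0) (isBihom_X_affineIdx_zero _ i)
      (isBihom_X_baseIdx _ i),
    W.ratio (X 2) (X (baseIdx i) ^ (2 * d) * X 3) (2 * d, 1) (isBihom_X2 _)
      (by simpa using isBihom_X_baseIdx_pow_mul_X3_pow (2 * d) i (2 * d, 1))]

/-- Polynomials in the affine coordinates of the `i`-th chart as rational functions on `𝒞`. -/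
def affineEval (i : Fin 2) : MvPolynomial (Fin 2) ℂ →ₐ[ℂ] W.functionField :=
  aeval (W.affineFn i)

@[simp] lemma affineEval_X (i j : Fin 2) : W.affineEval i (X j) = W.affineFn i j := aeval_X ..

lemma coe_affineEval (i : Fin 2) (P : MvPolynomial (Fin 2) ℂ) :
    (W.affineEval i P : FractionRing W.CoordRing) =
      aeval (affineCoord (2 * d) i fun j => W.res (X j)) P := by
  rw [affineEval, ← IntermediateField.coe_val, ← AlgHom.comp_apply, comp_aeval]
  congr 2
  funext j
  fin_cases j <;> simp [affineFn, affineCoord, ratio]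

lemma res_eq_affineEval (i : Fin 2) {A : MvPolynomial (Fin 4) ℂ} {n : ℕ × ℕ}
    (hA : IsBihom (2 * d) A n) : W.res A = W.res (X (baseIdx i)) ^ n.1 * W.res (X 3) ^ n.2 *
      W.affineEval i (dehom i A) := by
  rw [coe_affineEval, ← hA.aeval_eq (v := fun j => W.res (X j)) (W.res_X_baseIdx_ne_zero i)
    W.res_X3_ne_zero]
  exact DFunLike.congr_fun (aeval_unique W.res) A

lemma ratio_eq_div (i : Fin 2) {A B : MvPolynomial (Fin 4) ℂ} {n : ℕ × ℕ}
    (hA : IsBihom (2 * d) A n) (hB : IsBihom (2 * d) B n) :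
    W.ratio A B n hA hB = W.affineEval i (dehom i A) / W.affineEval i (dehom i B) := by
  apply Subtype.ext
  change W.res A / W.res B = _
  rw [W.res_eq_affineEval i hA, W.res_eq_affineEval i hB,
    mul_div_mul_left _ _ (mul_ne_zero (pow_ne_zero _ (W.res_X_baseIdx_ne_zero i))
      (pow_ne_zero _ W.res_X3_ne_zero))]
  rfl

lemma affineEval_dehom_eq_zero_iff (i : Fin 2) {A : MvPolynomial (Fin 4) ℂ} {n : ℕ × ℕ}
    (hA : IsBihom (2 * d) A n) : W.affineEval i (dehom i A) = 0 ↔ W.res A = 0 := by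
  rw [W.res_eq_affineEval i hA, mul_eq_zero_iff_left (mul_ne_zero
    (pow_ne_zero _ (W.res_X_baseIdx_ne_zero i)) (pow_ne_zero _ W.res_X3_ne_zero)),
    ZeroMemClass.coe_eq_zero]

lemma affineEval_eq_zero_iff (i : Fin 2) (P : MvPolynomial (Fin 2) ℂ) :
    W.affineEval i P = 0 ↔ dehom i W.cubic ∣ P := by
  constructor
  · intro h
    obtain ⟨n, A, hA, rfl⟩ := exists_isBihom_dehom_eq (2 * d) i P
    exact map_dvd _ ((W.res_eq_zero_iff A).1 ((W.affineEval_dehom_eq_zero_iff i hA).1 h))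
  · rintro ⟨B, rfl⟩
    rw [map_mul, (W.affineEval_dehom_eq_zero_iff i W.isBihom_cubic).2
      ((W.res_eq_zero_iff _).2 dvd_rfl), zero_mul]

lemma affineEval_ne_zero_of_degree_lt (i : Fin 2) {Q : Polynomial (Polynomial ℂ)} (hQ : Q ≠ 0)
    (hdeg : Q.degree < 3) : W.affineEval i (equivMvPolynomial ℂ Q) ≠ 0 := by
  obtain ⟨n, A, hA, hdA⟩ := exists_isBihom_dehom_eq (2 * d) i (equivMvPolynomial ℂ Q)
  rw [← hdA, ne_eq, W.affineEval_dehom_eq_zero_iff i hA]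
  exact W.res_ne_zero_of_degree_lt hdA hQ hdeg

lemma affineEval_pderiv_ne_zero (i : Fin 2) :
    W.affineEval i (pderiv 1 (dehom i W.cubic)) ≠ 0 := by
  have h3 : (W.bivariateCubic i).natDegree = 3 :=
    Polynomial.natDegree_eq_of_degree_eq_some (W.degree_bivariateCubic i)
  rw [dehom_cubic, Polynomial.Bivariate.pderiv_one_equivMvPolynomial]
  refine W.affineEval_ne_zero_of_degree_lt i (fun h => ?_) ?_
  · simp [Polynomial.derivative_eq_zero, h3] at h
  · rw [← W.degree_bivariateCubic i]
    exact Polynomial.degree_derivative_lt (W.monic_bivariateCubic i).ne_zero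

lemma affineEval_equivMvPolynomial_C (i : Fin 2) (p : Polynomial ℂ) :
    W.affineEval i (equivMvPolynomial ℂ (Polynomial.C p)) =
      Polynomial.aeval (W.affineFn i 0) p := by
  suffices h : ((W.affineEval i).comp (equivMvPolynomial ℂ).toAlgHom).comp Polynomial.CAlgHom =
      Polynomial.aeval (W.affineFn i 0) from DFunLike.congr_fun h p
  ext
  simp [affineEval]

lemma transcendental_affineFn_zero (i : Fin 2) : Transcendental ℂ (W.affineFn i 0) := by
  refine transcendental_iff.2 fun p hp => ?_
  by_contra h
  refine W.affineEval_ne_zero_of_degree_lt i (Polynomial.C_ne_zero.2 h)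
    (Polynomial.degree_C_le.trans_lt (by decide)) ?_
  rw [affineEval_equivMvPolynomial_C, hp]

lemma exists_eq_affineEval_div (i : Fin 2) (f : W.functionField) :
    ∃ a b, W.affineEval i b ≠ 0 ∧ f = W.affineEval i a / W.affineEval i b := by
  obtain ⟨f, n, A, B, hA, hB, h0, rfl⟩ := f
  exact ⟨dehom i A, dehom i B, (W.affineEval_dehom_eq_zero_iff i hB).not.2 h0,
    W.ratio_eq_div i hA hB⟩

lemma affineEval_ne_zero {i : Fin 2} {w : Fin 2 → ℂ} (hw : eval w (dehom i W.cubic) = 0)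
    {b : MvPolynomial (Fin 2) ℂ} (hb : eval w b ≠ 0) : W.affineEval i b ≠ 0 := by
  rw [ne_eq, affineEval_eq_zero_iff]
  rintro ⟨q, rfl⟩
  rw [map_mul, hw, zero_mul] at hb
  exact hb rfl

lemma mem_localRing_chartPoint_iff {i : Fin 2} {w : Fin 2 → ℂ}
    (hw : eval w (dehom i W.cubic) = 0) (f : W.functionField) :
    f ∈ W.localRing (chartPoint d i w) ↔
      ∃ a b, eval w b ≠ 0 ∧ f = W.affineEval i a / W.affineEval i b := by
  constructor
  · rintro ⟨n, A, B, hA, hB, -, hp, hf⟩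
    rw [chartPoint, hB.mk_mem_zeroLocus_iff, eval_chartCoord] at hp
    exact ⟨dehom i A, dehom i B, hp, W.ratio_eq_div i hA hB ▸ Subtype.ext hf⟩
  · rintro ⟨a, b, hb, rfl⟩
    obtain ⟨n, A, hA, rfl⟩ := exists_isBihom_dehom_eq (2 * d) i a
    obtain ⟨m, B, hB, rfl⟩ := exists_isBihom_dehom_eq (2 * d) i b
    -- multiplying by powers of the coordinates equal to one on the chart equalizes bidegrees
    have key := isBihom_X_baseIdx_pow_mul_X3_pow (2 * d) i
    have hA' := hA.mul (key m)
    have hB' : IsBihom (2 * d) _ (n + m) := (key n).mul hB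
    refine ⟨n + m, _, _, hA', hB', ?_, ?_, ?_⟩
    · rw [ne_eq, ← W.affineEval_dehom_eq_zero_iff i hB']
      simpa using W.affineEval_ne_zero hw hb
    · rw [chartPoint, hB'.mk_mem_zeroLocus_iff, eval_chartCoord]
      simpa using hb
    · have h := W.ratio_eq_div i hA' hB'
      simp only [map_mul, map_pow, dehom_X_baseIdx, dehom_X3, one_pow, mul_one, one_mul] at h
      rw [← h]
      rfl

end WeierstrassModel

/-! ### Local rings and orders -/

namespace Ruled

lemma IsBihom.isWeightedHomogeneous {M : Type*} [AddCommMonoid M] {e : ℕ}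
    {A : MvPolynomial (Fin 4) ℂ} {n : ℕ × ℕ} (hA : IsBihom e A n) (φ : ℕ × ℕ →+ M) :
    A.IsWeightedHomogeneous (φ ∘ weight e) (φ n) := by
  intro k hk
  rw [← hA hk, Finsupp.weight_apply, Finsupp.weight_apply, map_finsuppSum]
  simp only [Function.comp_apply, map_nsmul]

lemma IsBihom.eval_pderiv_eq_zero {e : ℕ} {A : MvPolynomial (Fin 4) ℂ} {n : ℕ × ℕ}
    (hA : IsBihom e A n) {i : Fin 2} {w : Fin 2 → ℂ} (h : eval w (dehom i A) = 0)
    (h' : ∀ j, eval w (pderiv j (dehom i A)) = 0) (k : Fin 4) :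
    eval (chartCoord i w).1 (pderiv k A) = 0 := by
  simp only [pderiv_dehom, ← eval_chartCoord] at h' h
  -- Euler's identities for the two gradings recover the partials in the directions set to one
  have E1 := congrArg (eval (chartCoord i w).1)
    (hA.isWeightedHomogeneous (AddMonoidHom.fst ℕ ℕ)).sum_weight_X_mul_pderiv
  have E2 := congrArg (eval (chartCoord i w).1)
    (hA.isWeightedHomogeneous (AddMonoidHom.snd ℕ ℕ)).sum_weight_X_mul_pderiv
  have h0 := h' 0
  have h1 := h' 1
  fin_cases i <;> fin_cases k <;>
    simp_all [Fin.sum_univ_four, weight, chartCoord, chartVec, affineIdx]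

end Ruled

namespace WeierstrassModel

variable {d : ℕ} {W : WeierstrassModel d}

lemma exists_eq_chartPoint {p : Surface (2 * d)} (hp : p ∈ W.branchCurve) {i : Fin 2}
    (hi : p ∉ zeroLocus (2 * d) (X (baseIdx i))) :
    ∃ w, p = chartPoint d i w ∧ eval w (dehom i W.cubic) = 0 := by
  obtain ⟨v, rfl⟩ : ∃ v, Ruled.mk (2 * d) v = p := Quotient.exists_rep p
  have hz : v.1 3 ≠ 0 := fun h => hp.2 ((mk_mem_sectionAtInfinity _ v).2 h)
  rw [(isBihom_X_baseIdx _ _).mk_mem_zeroLocus_iff, eval_X] at hi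
  have hv : Ruled.mk (2 * d) v = chartPoint d i (affineCoord (2 * d) i v.1) :=
    (mk_chartCoord_affineCoord hi hz).symm
  exact ⟨_, hv, (W.chartPoint_mem_branchCurve i _).1 (hv ▸ hp)⟩

open Classical in
/-- The index of a chart that contains `p`, chosen so that `denom p` is its homogeneous base
coordinate. -/
def chartIdx (p : Surface (2 * d)) : Fin 2 := if p ∈ zeroLocus (2 * d) (X 0) then 1 else 0

lemma denom_eq (p : Surface (2 * d)) : denom p = X (baseIdx (chartIdx p)) := by
  unfold denom chartIdx
  split_ifs <;> rfl

lemma exists_eq_chartPoint_chartIdx {p : Surface (2 * d)} (hp : p ∈ W.branchCurve) :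
    ∃ w, p = chartPoint d (chartIdx p) w ∧ eval w (dehom (chartIdx p) W.cubic) = 0 :=
  exists_eq_chartPoint hp (denom_eq p ▸ notMem_zeroLocus_denom p)

lemma IsSmooth.exists_eval_pderiv_ne_zero (hW : W.IsSmooth) {i : Fin 2} {w : Fin 2 → ℂ}
    (hw : eval w (dehom i W.cubic) = 0) : ∃ j, eval w (pderiv j (dehom i W.cubic)) ≠ 0 := by
  by_contra! h
  obtain ⟨k, hk⟩ := hW (chartCoord i w) ((W.chartPoint_mem_branchCurve i w).2 hw)
  exact hk (W.isBihom_cubic.eval_pderiv_eq_zero hw h k)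

variable [W.IsIrreducible]

section Germ

variable {i : Fin 2} {w : Fin 2 → ℂ} (hw : eval w (dehom i W.cubic) = 0)

/-- The germ at a point of a polynomial in the affine coordinates. -/
def germ : MvPolynomial (Fin 2) ℂ →ₐ[ℂ] W.localRing (chartPoint d i w) :=
  (W.affineEval i).codRestrict _ fun a =>
    (W.mem_localRing_chartPoint_iff hw _).2 ⟨a, 1, by simp, by simp⟩

lemma coe_germ (a : MvPolynomial (Fin 2) ℂ) :
    (germ hw a : W.functionField) = W.affineEval i a := rfl

lemma germ_dehom_cubic : germ hw (dehom i W.cubic) = 0 :=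
  Subtype.ext ((W.affineEval_eq_zero_iff i _).2 dvd_rfl)

lemma isUnit_germ_iff (a : MvPolynomial (Fin 2) ℂ) : IsUnit (germ hw a) ↔ eval w a ≠ 0 := by
  constructor
  · intro hu ha
    obtain ⟨r, hr⟩ := hu.exists_right_inv
    obtain ⟨b, c, hc, hrb⟩ := (W.mem_localRing_chartPoint_iff hw _).1 r.2
    have h1 : W.affineEval i a * (W.affineEval i b / W.affineEval i c) = 1 :=
      hrb ▸ congrArg Subtype.val hr
    rw [← mul_div_assoc, div_eq_one_iff_eq (W.affineEval_ne_zero hw hc)] at h1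
    refine W.affineEval_ne_zero hw (b := a * b - c) ?_ (by rw [map_sub, map_mul, h1, sub_self])
    simpa [ha] using hc
  · intro ha
    exact IsUnit.of_mul_eq_one ⟨1 / W.affineEval i a,
      (W.mem_localRing_chartPoint_iff hw _).2 ⟨1, a, ha, by simp⟩⟩
      (Subtype.ext (mul_one_div_cancel (W.affineEval_ne_zero hw ha)))

lemma not_isUnit_germ_X_sub_C (j : Fin 2) : ¬ IsUnit (germ hw (X j - C (w j))) := by
  rw [isUnit_germ_iff]
  simp

lemma exists_associated_germ (r : W.localRing (chartPoint d i w)) :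
    ∃ a, Associated (germ hw a) r := by
  obtain ⟨a, b, hb, h⟩ := (W.mem_localRing_chartPoint_iff hw _).1 r.2
  refine ⟨a, .symm ⟨((isUnit_germ_iff hw b).2 hb).unit, Subtype.ext ?_⟩⟩
  change (r : W.functionField) * W.affineEval i b = W.affineEval i a
  rw [h, div_mul_cancel₀ _ (W.affineEval_ne_zero hw hb)]

lemma isUniformizer_of_forall_dvd {π : W.localRing (chartPoint d i w)} (hπ : ¬ IsUnit π)
    (h : ∀ j, π ∣ germ hw (X j - C (w j))) : W.IsUniformizer (chartPoint d i w) π := by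
  refine fun r => ⟨fun h hu => hπ (isUnit_of_dvd_unit h hu), fun hr => ?_⟩
  obtain ⟨a, ha⟩ := exists_associated_germ hw r
  rw [← ha.isUnit_iff, isUnit_germ_iff, not_not] at hr
  obtain ⟨α, hα, -⟩ := exists_eq_C_eval_add_sum w a
  rw [← ha.dvd_iff_dvd_right, hα, hr, C_0, zero_add, map_sum]
  exact Finset.dvd_sum fun j _ => map_mul (germ hw) _ _ ▸ (h j).mul_right _

lemma isUniformizer_germ {j k : Fin 2} (hjk : j ≠ k)
    (hk : eval w (pderiv k (dehom i W.cubic)) ≠ 0) :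
    W.IsUniformizer (chartPoint d i w) (germ hw (X j - C (w j))) := by
  obtain ⟨α, h, hα⟩ := exists_eq_C_eval_add_sum w (dehom i W.cubic)
  have hsum := congrArg (germ hw) h
  have huniv : ∀ {j k : Fin 2}, j ≠ k → Finset.univ = {j, k} := by decide
  rw [germ_dehom_cubic, hw, C_0, zero_add, huniv hjk, Finset.sum_pair hjk, map_add,
    map_mul (germ hw), map_mul (germ hw)] at hsum
  rw [← hα, ← isUnit_germ_iff hw] at hk
  refine isUniformizer_of_forall_dvd hw (not_isUnit_germ_X_sub_C hw j) fun l => ?_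
  obtain rfl | rfl : l = j ∨ l = k := by simpa [huniv hjk] using Finset.mem_univ l
  · exact dvd_rfl
  · rw [← hk.dvd_mul_right]
    exact ⟨-germ hw (α j), by linear_combination -hsum⟩

end Germ

variable {p : Surface (2 * d)}

lemma IsSmooth.exists_isUniformizer (hW : W.IsSmooth) (hp : p ∈ W.branchCurve) :
    ∃ π, W.IsUniformizer p π := by
  obtain ⟨w, hpw, hw⟩ := exists_eq_chartPoint_chartIdx hp
  obtain ⟨k, hk⟩ := hW.exists_eval_pderiv_ne_zero hw
  obtain ⟨j, hjk⟩ := exists_ne k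
  rw [hpw]
  exact ⟨_, isUniformizer_germ hw hjk hk⟩

lemma isNoetherianRing_localRing (hp : p ∈ W.branchCurve) : IsNoetherianRing (W.localRing p) := by
  obtain ⟨w, hpw, hw⟩ := exists_eq_chartPoint_chartIdx hp
  rw [hpw]
  exact isNoetherianRing_of_forall_associated (germ hw).toRingHom (exists_associated_germ hw)

lemma exists_eq_div_of_mem_branchCurve (hp : p ∈ W.branchCurve) (f : W.functionField) :
    ∃ a b : W.localRing p, b ≠ 0 ∧ f = (a : W.functionField) / b := by
  obtain ⟨w, hpw, hw⟩ := exists_eq_chartPoint_chartIdx hp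
  obtain ⟨a, b, hb, hf⟩ := W.exists_eq_affineEval_div (chartIdx p) f
  rw [hpw]
  exact ⟨germ hw a, germ hw b, fun h => hb (congrArg Subtype.val h), hf⟩

lemma affineEval_X_zero_sub_C_ne_zero (i : Fin 2) (a : ℂ) : W.affineEval i (X 0 - C a) ≠ 0 := by
  intro h
  refine W.transcendental_affineFn_zero i ?_
  rw [map_sub, affineEval_X, sub_eq_zero, algHom_C] at h
  exact h ▸ isAlgebraic_algebraMap a

lemma IsUniformizer.coe_ne_zero {π : W.localRing p} (hπ : W.IsUniformizer p π)
    (hp : p ∈ W.branchCurve) : (π : W.functionField) ≠ 0 := by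
  intro h
  obtain rfl : π = 0 := Subtype.ext h
  obtain ⟨w, hpw, hw⟩ := exists_eq_chartPoint_chartIdx hp
  rw [hpw] at hπ
  exact affineEval_X_zero_sub_C_ne_zero _ (w 0)
    (congrArg Subtype.val (zero_dvd_iff.1 ((hπ _).2 (not_isUnit_germ_X_sub_C hw 0))))

lemma IsUniformizer.exists_unit_mul_eq {π π' : W.localRing p} (h : W.IsUniformizer p π)
    (h' : W.IsUniformizer p π') : ∃ u : (W.localRing p)ˣ, π' = u * π := by
  obtain ⟨u, hu⟩ :=
    associated_of_dvd_dvd ((h _).2 ((h' _).1 dvd_rfl)) ((h' _).2 ((h _).1 dvd_rfl))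
  exact ⟨u, by rw [mul_comm, hu]⟩

/-- Units of the local ring as units of the function field. -/
def unitsCoe (p : Surface (2 * d)) : (W.localRing p)ˣ →* W.functionFieldˣ :=
  Units.map (W.localRing p).val.toRingHom.toMonoidHom

lemma coe_unitsCoe (u : (W.localRing p)ˣ) :
    ((unitsCoe p u : W.functionFieldˣ) : W.functionField) = (u : W.localRing p) := rfl

lemma HasOrd.exists_unit {f : W.functionField} {n : ℤ} (h : W.HasOrd p f n) {π : W.localRing p}
    (hπ : W.IsUniformizer p π) :
    ∃ u : (W.localRing p)ˣ, f = (u : W.localRing p) * (π : W.functionField) ^ n := by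
  obtain ⟨π', u, hπ', rfl⟩ := h
  obtain ⟨v, rfl⟩ := hπ.exists_unit_mul_eq hπ'
  refine ⟨u * v ^ n, ?_⟩
  rw [← coe_unitsCoe, ← coe_unitsCoe, map_mul, map_zpow, Units.val_mul,
    Units.val_zpow_eq_zpow_val, mul_assoc, coe_unitsCoe v, ← mul_zpow]
  rfl

lemma HasOrd.mul (hp : p ∈ W.branchCurve) {f g : W.functionField} {m n : ℤ}
    (hf : W.HasOrd p f m) (hg : W.HasOrd p g n) : W.HasOrd p (f * g) (m + n) := by
  obtain ⟨π, u, hπ, rfl⟩ := hf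
  obtain ⟨v, rfl⟩ := hg.exists_unit hπ
  refine ⟨π, u * v, hπ, ?_⟩
  rw [zpow_add₀ (hπ.coe_ne_zero hp)]
  push_cast
  ring

lemma HasOrd.zpow {f : W.functionField} {m : ℤ} (hf : W.HasOrd p f m) (k : ℤ) :
    W.HasOrd p (f ^ k) (k * m) := by
  obtain ⟨π, u, hπ, rfl⟩ := hf
  refine ⟨π, u ^ k, hπ, ?_⟩
  rw [← coe_unitsCoe, ← coe_unitsCoe, map_zpow, Units.val_zpow_eq_zpow_val, mul_zpow,
    ← zpow_mul, mul_comm k m]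

lemma HasOrd.eq_unit_mul {f g : W.functionField} {n : ℤ} (hf : W.HasOrd p f n)
    (hg : W.HasOrd p g n) : ∃ u : (W.localRing p)ˣ, f = (u : W.localRing p) * g := by
  obtain ⟨π, u, hπ, rfl⟩ := hf
  obtain ⟨v, rfl⟩ := hg.exists_unit hπ
  refine ⟨u * v⁻¹, ?_⟩
  rw [← coe_unitsCoe, ← coe_unitsCoe, ← coe_unitsCoe, ← mul_assoc, ← Units.val_mul, ← map_mul,
    inv_mul_cancel_right]

lemma unit_mul_mem_localRing_iff (u : (W.localRing p)ˣ) (f : W.functionField) :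
    ((u : W.localRing p) : W.functionField) * f ∈ W.localRing p ↔ f ∈ W.localRing p := by
  refine ⟨fun h => ?_, fun h => mul_mem (SetLike.coe_mem _) h⟩
  have := mul_mem (SetLike.coe_mem ((u⁻¹ : (W.localRing p)ˣ) : W.localRing p)) h
  rwa [← mul_assoc, ← MulMemClass.coe_mul, Units.inv_mul, OneMemClass.coe_one, one_mul] at this

lemma IsSmooth.hasOrd_unit (hW : W.IsSmooth) (hp : p ∈ W.branchCurve) (u : (W.localRing p)ˣ) :
    W.HasOrd p ((u : W.localRing p) : W.functionField) 0 := by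
  obtain ⟨π, hπ⟩ := hW.exists_isUniformizer hp
  exact ⟨π, u, hπ, by simp⟩

lemma IsUniformizer.exists_hasOrd_coe {π : W.localRing p} (hπ : W.IsUniformizer p π)
    (hp : p ∈ W.branchCurve) {a : W.localRing p} (ha : a ≠ 0) : ∃ n, W.HasOrd p a n := by
  have := isNoetherianRing_localRing hp
  obtain ⟨n, v, rfl⟩ := exists_unit_mul_pow_of_dvd_iff hπ ha
  exact ⟨n, π, v, hπ, by rw [zpow_natCast]; rfl⟩

lemma IsSmooth.exists_hasOrd (hW : W.IsSmooth) (hp : p ∈ W.branchCurve) {f : W.functionField}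
    (hf : f ≠ 0) : ∃ n, W.HasOrd p f n := by
  obtain ⟨π, hπ⟩ := hW.exists_isUniformizer hp
  obtain ⟨a, b, hb, rfl⟩ := exists_eq_div_of_mem_branchCurve hp f
  obtain ⟨m, hm⟩ := hπ.exists_hasOrd_coe hp (a := a) (by rintro rfl; simp at hf)
  obtain ⟨n, hn⟩ := hπ.exists_hasOrd_coe hp hb
  refine ⟨m + (-1) * n, ?_⟩
  rw [div_eq_mul_inv, ← zpow_neg_one]
  exact hm.mul hp (hn.zpow (-1))

lemma IsSmooth.hasOrd_ord (hW : W.IsSmooth) (hp : p ∈ W.branchCurve) {f : W.functionField}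
    (hf : f ≠ 0) : W.HasOrd p f (W.ord p f) := by
  rw [ord, dif_pos (hW.exists_hasOrd hp hf)]
  exact Exists.choose_spec _

end WeierstrassModel

/-! ### Sections of multiples of a fibre -/

namespace WeierstrassModel

open Polynomial.Bivariate (equivMvPolynomial)

variable {d : ℕ} (W : WeierstrassModel d) [W.IsIrreducible]

lemma exists_eq_affineEval_of_regular (i : Fin 2) (g : W.functionField)
    (hg : ∀ w, eval w (dehom i W.cubic) = 0 → g ∈ W.localRing (chartPoint d i w)) :
    ∃ P, g = W.affineEval i P := by
  let denominators : Ideal (MvPolynomial (Fin 2) ℂ) :=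
    { carrier := {b | ∃ a, W.affineEval i b * g = W.affineEval i a}
      add_mem' := by
        rintro b b' ⟨a, ha⟩ ⟨a', ha'⟩
        exact ⟨a + a', by rw [map_add, add_mul, ha, ha', map_add]⟩
      zero_mem' := ⟨0, by simp⟩
      smul_mem' := by
        rintro c b ⟨a, ha⟩
        exact ⟨c * a, by rw [smul_eq_mul, map_mul, mul_assoc, ha, map_mul]⟩ }
  -- a maximal ideal containing all denominators of `g` is a point of `𝒞` where `g` is not regular
  by_cases hI : denominators = ⊤
  · obtain ⟨a, ha⟩ : (1 : MvPolynomial (Fin 2) ℂ) ∈ denominators := hI ▸ Submodule.mem_top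
    exact ⟨a, by rw [← ha, map_one, one_mul]⟩
  · obtain ⟨M, hM, hIM⟩ := Ideal.exists_le_maximal denominators hI
    obtain ⟨w, rfl⟩ := isMaximal_iff_eq_vanishingIdeal_singleton.1 hM
    have eval_eq_zero (b) (hb : b ∈ denominators) : eval w b = 0 := by
      simpa only [aeval_eq_eval] using (mem_vanishingIdeal_singleton_iff w b).1 (hIM hb)
    have hw : eval w (dehom i W.cubic) = 0 :=
      eval_eq_zero _ ⟨0, by rw [(W.affineEval_eq_zero_iff i _).2 dvd_rfl, map_zero, zero_mul]⟩
    obtain ⟨a, b, hb, rfl⟩ := (W.mem_localRing_chartPoint_iff hw g).1 (hg w hw)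
    exact absurd (eval_eq_zero b ⟨a, mul_div_cancel₀ _ (W.affineEval_ne_zero hw hb)⟩) hb

/-- The function `a₀(u) + a₁(u) x + a₂(u) x²`, where `u` and `x` are the base and fibre coordinates
of the `i`-th chart. -/
def coeffSum (i : Fin 2) : (Fin 3 → Polynomial ℂ) →ₗ[ℂ] W.functionField :=
  ∑ j : Fin 3, LinearMap.mulRight ℂ (W.affineFn i 1 ^ (j : ℕ)) ∘ₗ
    (Polynomial.aeval (W.affineFn i 0)).toLinearMap ∘ₗ LinearMap.proj j

lemma coeffSum_apply (i : Fin 2) (a : Fin 3 → Polynomial ℂ) : W.coeffSum i a =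
    ∑ j : Fin 3, Polynomial.aeval (W.affineFn i 0) (a j) * W.affineFn i 1 ^ (j : ℕ) := by
  simp [coeffSum]

lemma affineEval_equivMvPolynomial_sum (i : Fin 2) (a : Fin 3 → Polynomial ℂ) :
    W.affineEval i (equivMvPolynomial ℂ
      (∑ j : Fin 3, Polynomial.C (a j) * Polynomial.X ^ (j : ℕ))) = W.coeffSum i a := by
  simp only [coeffSum_apply, map_sum, map_mul, map_pow, affineEval_equivMvPolynomial_C,
    Polynomial.Bivariate.equivMvPolynomial_X, affineEval_X]

lemma coeffSum_injective (i : Fin 2) : Function.Injective (W.coeffSum i) := by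
  rw [← LinearMap.ker_eq_bot, LinearMap.ker_eq_bot']
  intro a ha
  rw [← affineEval_equivMvPolynomial_sum] at ha
  have h0 := not_imp_not.1 (W.affineEval_ne_zero_of_degree_lt i · (Polynomial.degree_sum_fin_lt a))
    ha
  funext j
  simpa [Polynomial.finsetSum_coeff, Polynomial.coeff_C_mul, Polynomial.coeff_X_pow,
    Fin.val_inj] using congrArg (Polynomial.coeff · j) h0

lemma exists_eq_coeffSum (i : Fin 2) (P : MvPolynomial (Fin 2) ℂ) :
    ∃ a, W.affineEval i P = W.coeffSum i a := by
  obtain ⟨Q, rfl⟩ := (equivMvPolynomial ℂ).surjective P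
  have hdeg : (Q %ₘ W.bivariateCubic i).natDegree < 3 := by
    have h3 := Polynomial.natDegree_eq_of_degree_eq_some (W.degree_bivariateCubic i)
    rw [← h3]
    exact Polynomial.natDegree_modByMonic_lt Q (W.monic_bivariateCubic i) fun h => by
      simp [h] at h3
  refine ⟨fun j => (Q %ₘ W.bivariateCubic i).coeff j, ?_⟩
  have h0 : W.affineEval i (equivMvPolynomial ℂ (W.bivariateCubic i)) = 0 := by
    rw [← dehom_cubic]
    exact (W.affineEval_eq_zero_iff i _).2 dvd_rfl
  conv_lhs => rw [← Polynomial.modByMonic_add_div Q (W.bivariateCubic i), map_add, map_mul,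
    map_add, map_mul, h0, zero_mul, add_zero, Polynomial.as_sum_range_C_mul_X_pow' _ hdeg]
  rw [Finset.sum_range, affineEval_equivMvPolynomial_sum]

/-- The first base coordinate divided by the base coordinate that is nonzero on the `i`-th chart. -/
def transition (i : Fin 2) : W.functionField := W.affineEval i (dehom i (X 0))

lemma transition_zero : W.transition 0 = 1 := by
  rw [transition, dehom_zero_X0, map_one]

lemma affineFn_one_zero : W.affineFn 1 0 = W.transition 1 := by
  rw [transition, dehom_one_X0, affineEval_X]

lemma affineEval_dehom_eq (i : Fin 2) {A : MvPolynomial (Fin 4) ℂ} {n : ℕ × ℕ}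
    (hA : IsBihom (2 * d) A n) : W.affineEval i (dehom i A) =
      W.affineEval 0 (dehom 0 A) * W.transition i ^ n.1 := by
  have hbase : W.res (X (baseIdx 0)) = W.res (X (baseIdx i)) * W.transition i := by
    simpa [transition, baseIdx] using W.res_eq_affineEval i (isBihom_X0 (2 * d))
  have hA' := (W.res_eq_affineEval i hA).symm.trans (W.res_eq_affineEval 0 hA)
  rw [hbase, mul_pow] at hA'
  have hi := pow_ne_zero n.1 (W.res_X_baseIdx_ne_zero i)
  have hz := pow_ne_zero n.2 W.res_X3_ne_zero
  apply Subtype.ext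
  refine mul_left_cancel₀ (mul_ne_zero hi hz) (hA'.trans ?_)
  push_cast
  ring

lemma affineFn_zero_ne_zero (i : Fin 2) : W.affineFn i 0 ≠ 0 :=
  fun h => W.transcendental_affineFn_zero i (h ▸ isAlgebraic_zero)

lemma transition_one : W.transition 1 = (W.affineFn 0 0)⁻¹ := by
  have h := W.affineEval_dehom_eq 1 (isBihom_X1 (2 * d))
  rw [dehom_zero_X1, dehom_one_X1, map_one, affineEval_X, pow_one] at h
  exact eq_inv_of_mul_eq_one_right h.symm

lemma affineFn_one_one : W.affineFn 1 1 = W.affineFn 0 1 * W.transition 1 ^ (2 * d) := by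
  simpa using W.affineEval_dehom_eq 1 (isBihom_X2 (2 * d))

/-- The sections over `𝒞` of the `k`-th multiple of a fibre, trivialized by the `k`-th power of the
first base coordinate. -/
def fibreSections (k : ℕ) : Submodule ℂ W.functionField where
  carrier := {g | ∀ p ∈ W.branchCurve, g * W.transition (chartIdx p) ^ k ∈ W.localRing p}
  add_mem' := fun hf hg p hp => by rw [add_mul]; exact add_mem (hf p hp) (hg p hp)
  zero_mem' := fun p _ => by rw [zero_mul]; exact zero_mem _
  smul_mem' := fun a f hf p hp => by
    rw [smul_mul_assoc]; exact Subalgebra.smul_mem _ (hf p hp) a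

lemma affineEval_dehom_mem_fibreSections {A : MvPolynomial (Fin 4) ℂ} {n : ℕ × ℕ}
    (hA : IsBihom (2 * d) A n) : W.affineEval 0 (dehom 0 A) ∈ W.fibreSections n.1 := by
  intro p hp
  obtain ⟨w, hpw, hw⟩ := exists_eq_chartPoint_chartIdx hp
  rw [← affineEval_dehom_eq _ _ hA]
  generalize chartIdx p = i at hpw hw ⊢
  rw [hpw]
  exact (germ hw (dehom i A)).2

lemma pow_mul_pow_mem_fibreSections {k n j : ℕ} (h : n + 2 * d * j ≤ k) :
    W.affineFn 0 0 ^ n * W.affineFn 0 1 ^ j ∈ W.fibreSections k := by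
  rw [mul_comm (2 * d)] at h
  obtain ⟨m, rfl⟩ := Nat.exists_eq_add_of_le' h
  have hA := ((isBihom_X0 (2 * d)).pow m).mul
    (((isBihom_X1 (2 * d)).pow n).mul ((isBihom_X2 (2 * d)).pow j))
  convert W.affineEval_dehom_mem_fibreSections hA using 1
  · simp
  · simp

variable {W}

lemma mul_transition_pow_mem_localRing {k : ℕ} {g : W.functionField} (hg : g ∈ W.fibreSections k)
    {i : Fin 2} {w : Fin 2 → ℂ} (hw : eval w (dehom i W.cubic) = 0) :
    g * W.transition i ^ k ∈ W.localRing (chartPoint d i w) := by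
  have h := hg _ ((W.chartPoint_mem_branchCurve i w).2 hw)
  by_cases hi : chartIdx (chartPoint d i w) = 0
  · rw [hi, transition_zero, one_pow, mul_one] at h
    exact mul_mem h (pow_mem (germ hw (dehom i (X 0))).2 k)
  · have h1 : chartIdx (chartPoint d i w) = 1 := by omega
    obtain rfl : i = 1 := by
      by_contra hi'
      obtain rfl : i = 0 := by omega
      refine hi (if_neg ?_)
      rw [chartPoint, (isBihom_X0 _).mk_mem_zeroLocus_iff, eval_chartCoord, dehom_zero_X0, map_one]
      exact one_ne_zero
    rwa [h1] at h

lemma exists_mul_transition_pow_eq_coeffSum {k : ℕ} {g : W.functionField}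
    (hg : g ∈ W.fibreSections k) (i : Fin 2) : ∃ a, g * W.transition i ^ k = W.coeffSum i a := by
  obtain ⟨P, hP⟩ := W.exists_eq_affineEval_of_regular i _ fun w hw =>
    mul_transition_pow_mem_localRing hg hw
  rw [hP]
  exact W.exists_eq_coeffSum i P

lemma natDegree_add_le_of_coeffSum_mem {k : ℕ} {a : Fin 3 → Polynomial ℂ}
    (ha : W.coeffSum 0 a ∈ W.fibreSections k) {j : Fin 3} (hj : a j ≠ 0) :
    (a j).natDegree + 2 * d * j ≤ k := by
  obtain ⟨b, hb⟩ := exists_mul_transition_pow_eq_coeffSum ha 1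
  have hu := W.affineFn_zero_ne_zero 0
  rw [transition_one, inv_pow, mul_inv_eq_iff_eq_mul₀ (pow_ne_zero _ hu)] at hb
  simp only [coeffSum_apply, affineFn_one_one, affineFn_one_zero, transition_one] at hb
  have h := aeval_eq_of_sum_eq_sum_aeval_inv hu
    (Q := fun j : Fin 3 => Polynomial.X ^ (2 * d * (j : ℕ)) * b j)
    (fun a a' h => W.coeffSum_injective 0 (by simpa only [coeffSum_apply] using h))
    (hb.trans (congrArg (· * _) (Finset.sum_congr rfl fun j _ => by
      rw [map_mul, map_pow, Polynomial.aeval_X, mul_pow, ← pow_mul]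
      ring))) j
  refine natDegree_add_le_of_transcendental (W.transcendental_affineFn_zero 0) (Q := b j) hj ?_
  rw [h, map_mul, map_pow, Polynomial.aeval_X, inv_pow]
  field_simp

lemma coeffSum_mem_fibreSections {k : ℕ} {a : Fin 3 → Polynomial ℂ}
    (ha : ∀ j : Fin 3, a j ∈ Polynomial.degreeLT ℂ (k + 1 - 2 * d * j)) :
    W.coeffSum 0 a ∈ W.fibreSections k := by
  rw [coeffSum_apply]
  refine Submodule.sum_mem _ fun j _ => ?_
  rw [Polynomial.aeval_def, Polynomial.eval₂_eq_sum, Polynomial.sum, Finset.sum_mul]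
  refine Submodule.sum_mem _ fun n hn => ?_
  have hnj : n < k + 1 - 2 * d * j := WithBot.coe_lt_coe.1
    ((Polynomial.le_degree_of_mem_supp n hn).trans_lt (Polynomial.mem_degreeLT.1 (ha j)))
  rw [mul_assoc, ← Algebra.smul_def]
  exact Submodule.smul_mem _ _ (W.pow_mul_pow_mem_fibreSections (by omega))

variable (W)

lemma range_coeffSum_degreeLT (k : ℕ) : LinearMap.range (W.coeffSum 0 ∘ₗ LinearMap.piMap
      fun j : Fin 3 => (Polynomial.degreeLT ℂ (k + 1 - 2 * d * j)).subtype) =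
    W.fibreSections k := by
  apply le_antisymm
  · rintro _ ⟨a, rfl⟩
    exact coeffSum_mem_fibreSections fun j => (a j).2
  · intro g hg
    obtain ⟨a, ha⟩ := exists_mul_transition_pow_eq_coeffSum hg 0
    rw [transition_zero, one_pow, mul_one] at ha
    subst ha
    refine ⟨fun j => ⟨a j, Polynomial.mem_degreeLT.2 ?_⟩, rfl⟩
    by_cases h0 : a j = 0
    · rw [h0, Polynomial.degree_zero]
      exact WithBot.bot_lt_coe _
    · have := natDegree_add_le_of_coeffSum_mem hg h0
      rw [← Polynomial.natDegree_lt_iff_degree_lt h0]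
      omega

theorem finrank_fibreSections (k : ℕ) : Module.finrank ℂ (W.fibreSections k) =
    (k + 1) + (k + 1 - 2 * d) + (k + 1 - 4 * d) := by
  have hfin (n) : Module.Finite ℂ (Polynomial.degreeLT ℂ n) :=
    Module.Finite.equiv (Polynomial.degreeLTEquiv ℂ n).symm
  have hrank (n) : Module.finrank ℂ (Polynomial.degreeLT ℂ n) = n := by
    rw [(Polynomial.degreeLTEquiv ℂ n).finrank_eq, Module.finrank_fin_fun]
  rw [← range_coeffSum_degreeLT, LinearMap.finrank_range_of_inj ?_]
  · simp only [Module.finrank_pi_fintype, hrank, Fin.sum_univ_three, Fin.val_zero, Fin.val_one,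
      Fin.val_two]
    omega
  · rw [LinearMap.coe_comp, LinearMap.coe_piMap]
    exact (W.coeffSum_injective 0).comp (Function.Injective.piMap fun j => Subtype.val_injective)

end WeierstrassModel

/-! ### Differential forms -/

namespace WeierstrassModel

open KaehlerDifferential

lemma exists_lift_eq_C {a : MvPolynomial (Fin 2) ℂ} (ha : a.IsHomogeneous 0) :
    ∃ r, lift a = C r := by
  rw [← totalDegree_zero_iff_isHomogeneous, totalDegree_eq_zero_iff_eq_C] at ha
  exact ⟨_, by rw [ha, lift, rename_C]⟩

lemma exists_cubic_eq_mul (W : WeierstrassModel 0) : ∃ x a b : ℂ, W.cubic =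
    (X 2 - C x * X 3) * (X 2 ^ 2 + C a * X 2 * X 3 + C b * X 3 ^ 2) := by
  obtain ⟨p, hp⟩ := exists_lift_eq_C W.hom₂
  obtain ⟨q, hq⟩ := exists_lift_eq_C W.hom₄
  obtain ⟨r, hr⟩ := exists_lift_eq_C W.hom₆
  let Q : Polynomial ℂ := Polynomial.X ^ 3 + (Polynomial.C p * Polynomial.X ^ 2 +
    Polynomial.C q * Polynomial.X + Polynomial.C r)
  have hQ : Q.degree = 3 := by
    unfold Q
    compute_degree!
  obtain ⟨x, hx⟩ := IsAlgClosed.exists_root Q (by rw [hQ]; decide)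
  have hx' : x ^ 3 + (p * x ^ 2 + q * x + r) = 0 := by simpa [Q] using hx
  refine ⟨x, p + x, q + x * (p + x), ?_⟩
  have hC := congrArg (C : ℂ → MvPolynomial (Fin 4) ℂ) hx'
  rw [cubic, hp, hq, hr]
  simp only [map_add, map_mul, map_pow, map_zero] at hC ⊢
  linear_combination (X 3) ^ 3 * hC

lemma pos_of_isIrreducible {d : ℕ} (W : WeierstrassModel d) [W.IsIrreducible] : 0 < d := by
  rw [Nat.pos_iff_ne_zero]
  rintro rfl
  obtain ⟨x, a, b, hfac⟩ := W.exists_cubic_eq_mul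
  obtain h | h := (IsIrreducible.irreducible (W := W)).isUnit_or_isUnit hfac <;>
    simpa using h.map (eval (0 : Fin 4 → ℂ))

variable {d : ℕ} (W : WeierstrassModel d)

/-- The Hamiltonian derivation `∂ₓG ∂ᵤ - ∂ᵤG ∂ₓ` of the equation `G` of `𝒞` on the `i`-th chart,
which is tangent to `𝒞`. -/
def hamiltonian (i : Fin 2) :
    Derivation ℂ (MvPolynomial (Fin 2) ℂ) (MvPolynomial (Fin 2) ℂ) :=
  pderiv 1 (dehom i W.cubic) • pderiv 0 - pderiv 0 (dehom i W.cubic) • pderiv 1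

lemma hamiltonian_apply (i : Fin 2) (a : MvPolynomial (Fin 2) ℂ) : W.hamiltonian i a =
    pderiv 1 (dehom i W.cubic) * pderiv 0 a - pderiv 0 (dehom i W.cubic) * pderiv 1 a := rfl

lemma eval_hamiltonian_X_sub_C_ne_zero {i j k : Fin 2} {w : Fin 2 → ℂ} (hjk : j ≠ k)
    (hk : eval w (pderiv k (dehom i W.cubic)) ≠ 0) (a : ℂ) :
    eval w (W.hamiltonian i (X j - C a)) ≠ 0 := by
  rw [hamiltonian_apply]
  fin_cases j <;> fin_cases k <;> simp_all [pderiv_X]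

variable [W.IsIrreducible]

/-- The residue form `du / ∂ₓG` on the `i`-th chart, where `u` and `x` are the base and fibre
coordinates and `G` is the equation of `𝒞`. -/
def residueForm (i : Fin 2) : Ω[W.functionField⁄ℂ] :=
  (W.affineEval i (pderiv 1 (dehom i W.cubic)))⁻¹ • D ℂ W.functionField (W.affineFn i 0)

lemma residueForm_ne_zero (i : Fin 2) : W.residueForm i ≠ 0 :=
  smul_ne_zero (inv_ne_zero (W.affineEval_pderiv_ne_zero i))
    (D_ne_zero_of_transcendental (W.transcendental_affineFn_zero i))

lemma D_affineEval (i : Fin 2) (a : MvPolynomial (Fin 2) ℂ) : D ℂ W.functionField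
    (W.affineEval i a) = W.affineEval i (W.hamiltonian i a) • W.residueForm i := by
  have hD (b) : D ℂ W.functionField (W.affineEval i b) =
      W.affineEval i (pderiv 0 b) • D ℂ W.functionField (W.affineFn i 0) +
        W.affineEval i (pderiv 1 b) • D ℂ W.functionField (W.affineFn i 1) := by
    rw [affineEval, derivation_aeval, Fin.sum_univ_two]
  have hG := hD (dehom i W.cubic)
  rw [(W.affineEval_eq_zero_iff i _).2 dvd_rfl, map_zero] at hG
  rw [hD, smul_add_smul_eq_of_smul_add_smul_eq_zero (W.affineEval_pderiv_ne_zero i) hG.symm,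
    hamiltonian_apply, map_sub, map_mul, map_mul, residueForm]

lemma D_affineEval_div (i : Fin 2) (a b : MvPolynomial (Fin 2) ℂ) :
    D ℂ W.functionField (W.affineEval i a / W.affineEval i b) =
      (W.affineEval i (b * W.hamiltonian i a - a * W.hamiltonian i b) / W.affineEval i (b ^ 2)) •
        W.residueForm i := by
  rw [Derivation.leibniz_div, D_affineEval, D_affineEval, smul_smul, smul_smul, ← sub_smul,
    smul_smul, ← map_mul, ← map_mul, ← map_sub, map_pow, inv_pow, inv_mul_eq_div]

lemma exists_eq_smul_residueForm (i : Fin 2) (ω : Ω[W.functionField⁄ℂ]) :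
    ∃ g : W.functionField, ω = g • W.residueForm i := by
  suffices h : Submodule.span W.functionField (Set.range (D ℂ W.functionField)) ≤
      Submodule.span W.functionField {W.residueForm i} by
    rw [span_range_derivation] at h
    obtain ⟨g, hg⟩ := Submodule.mem_span_singleton.1 (h (Submodule.mem_top (x := ω)))
    exact ⟨g, hg.symm⟩
  rw [Submodule.span_le]
  rintro _ ⟨f, rfl⟩
  obtain ⟨a, b, -, rfl⟩ := W.exists_eq_affineEval_div i f
  rw [D_affineEval_div]
  exact Submodule.smul_mem _ _ (Submodule.mem_span_singleton_self _)

variable {W}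

lemma exists_D_eq_smul_residueForm {i : Fin 2} {w : Fin 2 → ℂ}
    (hw : eval w (dehom i W.cubic) = 0) (r : W.localRing (chartPoint d i w)) :
    ∃ s : W.localRing (chartPoint d i w),
      D ℂ W.functionField r = (s : W.functionField) • W.residueForm i := by
  obtain ⟨r, hr⟩ := r
  obtain ⟨a, b, hb, rfl⟩ := (W.mem_localRing_chartPoint_iff hw r).1 hr
  refine ⟨⟨_, (W.mem_localRing_chartPoint_iff hw _).2 ⟨_, b ^ 2, ?_, rfl⟩⟩,
    W.D_affineEval_div i a b⟩
  rw [map_pow]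
  exact pow_ne_zero 2 hb

lemma IsSmooth.D_uniformizer_chartPoint (hW : W.IsSmooth) {i : Fin 2} {w : Fin 2 → ℂ}
    (hw : eval w (dehom i W.cubic) = 0) {π : W.localRing (chartPoint d i w)}
    (hπ : W.IsUniformizer _ π) : ∃ t : (W.localRing (chartPoint d i w))ˣ,
      D ℂ W.functionField π =
        ((t : W.localRing (chartPoint d i w)) : W.functionField) • W.residueForm i := by
  obtain ⟨k, hk⟩ := hW.exists_eval_pderiv_ne_zero hw
  obtain ⟨j, hjk⟩ := exists_ne k
  have hπ₀ := isUniformizer_germ hw hjk hk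
  obtain ⟨v, hv⟩ := (isUnit_germ_iff hw _).2 (W.eval_hamiltonian_X_sub_C_ne_zero hjk hk (w j))
  obtain ⟨u, rfl⟩ := hπ₀.exists_unit_mul_eq hπ
  obtain ⟨s, hs⟩ := exists_D_eq_smul_residueForm hw u
  obtain ⟨t, ht⟩ := exists_unit_mul_add_mul_eq hπ₀ u v s
  refine ⟨t, ?_⟩
  rw [MulMemClass.coe_mul, Derivation.leibniz, hs, coe_germ, D_affineEval, smul_smul, smul_smul,
    ← add_smul, ht, hv]
  simp only [AddMemClass.coe_add, MulMemClass.coe_mul, coe_germ]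

lemma IsSmooth.D_uniformizer (hW : W.IsSmooth) {p : Surface (2 * d)} (hp : p ∈ W.branchCurve)
    {π : W.localRing p} (hπ : W.IsUniformizer p π) : ∃ t : (W.localRing p)ˣ,
      D ℂ W.functionField π =
        ((t : W.localRing p) : W.functionField) • W.residueForm (chartIdx p) := by
  obtain ⟨w, hpw, hw⟩ := exists_eq_chartPoint_chartIdx hp
  generalize chartIdx p = i at hpw hw ⊢
  subst hpw
  exact hW.D_uniformizer_chartPoint hw hπ

variable (W)

lemma affineEval_one_pderiv : W.affineEval 1 (pderiv 1 (dehom 1 W.cubic)) =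
    W.affineEval 0 (pderiv 1 (dehom 0 W.cubic)) * W.transition 1 ^ (4 * d) := by
  have hbideg : (4 * d, 2) + weight (2 * d) 2 = (6 * d, 3) := Prod.ext (by simp [weight]; ring) rfl
  rw [pderiv_dehom, pderiv_dehom]
  exact W.affineEval_dehom_eq 1 (W.isBihom_cubic.pderiv hbideg)

lemma residueForm_zero_eq (i : Fin 2) : ∃ ε : ℂˣ, W.residueForm 0 =
    (algebraMap ℂ W.functionField ε * W.transition i ^ (4 * d - 2)) • W.residueForm i := by
  obtain rfl | rfl : i = 0 ∨ i = 1 := by omega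
  · exact ⟨1, by simp [transition_zero]⟩
  · refine ⟨-1, ?_⟩
    obtain ⟨n, hn⟩ : ∃ n, 4 * d = n + 2 := ⟨4 * d - 2, by have := W.pos_of_isIrreducible; omega⟩
    have hu := W.affineFn_zero_ne_zero 0
    have hx := W.affineEval_pderiv_ne_zero 0
    rw [residueForm, residueForm, affineEval_one_pderiv, affineFn_one_zero, transition_one,
      Derivation.leibniz_inv, smul_smul, smul_smul, hn, Nat.add_sub_cancel]
    congr 1
    simp only [Units.val_neg, Units.val_one, map_neg, map_one, inv_pow]
    field_simp
    ring

end WeierstrassModel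

/-! ### Divisors equivalent to multiples of a fibre -/

namespace WeierstrassModel

variable {d : ℕ} (W : WeierstrassModel d) [W.IsIrreducible]

/-- The equation of a fibre as a function on the chart `0`. -/
def fibreFunction (c : Fin 2 → ℂ) : W.functionField := W.affineEval 0 (dehom 0 (fibreForm c))

lemma fibreFunction_ne_zero {c : Fin 2 → ℂ} (hc : c ≠ 0) : W.fibreFunction c ≠ 0 := by
  intro h
  have h' := transcendental_iff.1 (W.transcendental_affineFn_zero 0)
    (Polynomial.C (c 1) - Polynomial.C (c 0) * Polynomial.X)
    (by simpa [fibreFunction, fibreForm, algHom_C] using h)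
  refine hc (funext fun j => ?_)
  fin_cases j
  · simpa using congrArg (Polynomial.coeff · 1) h'
  · simpa using congrArg (Polynomial.coeff · 0) h'

lemma fibreEquation_eq (c : Fin 2 → ℂ) (p : Surface (2 * d)) :
    W.fibreEquation c p = W.fibreFunction c * W.transition (chartIdx p) := by
  rw [fibreEquation, W.ratio_eq_div (chartIdx p), denom_eq, dehom_X_baseIdx, map_one, div_one,
    W.affineEval_dehom_eq _ (isBihom_fibreForm (2 * d) c), pow_one, fibreFunction]

lemma transition_ne_zero (i : Fin 2) : W.transition i ≠ 0 := by
  obtain rfl | rfl : i = 0 ∨ i = 1 := by omega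
  · exact W.transition_zero ▸ one_ne_zero
  · exact W.affineFn_one_zero ▸ W.affineFn_zero_ne_zero 1

lemma fibreEquation_ne_zero {c : Fin 2 → ℂ} (hc : c ≠ 0) (p : Surface (2 * d)) :
    W.fibreEquation c p ≠ 0 := by
  rw [fibreEquation_eq]
  exact mul_ne_zero (W.fibreFunction_ne_zero hc) (W.transition_ne_zero _)

variable {W}

lemma IsSmooth.exists_hasOrd_of_linEquiv (hW : W.IsSmooth) {θ : W.Divisor} {c : Fin 2 → ℂ}
    {hc : c ≠ 0} {k : ℕ} (hθ : W.LinEquiv θ ((k : ℤ) • W.fibreDivisor c hc)) :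
    ∃ m ≠ 0, ∀ p : W.branchCurve, W.HasOrd p (m * W.transition (chartIdx p.1) ^ k) (θ p) := by
  obtain ⟨f, hf, h⟩ := hθ
  refine ⟨f * W.fibreFunction c ^ k, mul_ne_zero hf (pow_ne_zero _ (W.fibreFunction_ne_zero hc)),
    fun p => ?_⟩
  have hF : W.HasOrd p (W.fibreEquation c p) (W.fibreDivisor c hc p) :=
    hW.hasOrd_ord p.2 (W.fibreEquation_ne_zero hc p)
  have hmul := (h p).mul p.2 (hF.zpow k)
  rw [Finsupp.smul_apply, smul_eq_mul, sub_add_cancel, zpow_natCast, fibreEquation_eq, mul_pow,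
    ← mul_assoc] at hmul
  exact hmul

lemma IsSmooth.linEquiv_refl (hW : W.IsSmooth) (θ : W.Divisor) : W.LinEquiv θ θ :=
  ⟨1, one_ne_zero, fun p => by simpa using hW.hasOrd_unit p.2 1⟩

lemma mem_H0_iff {θ : W.Divisor} {m : W.functionField} {k : ℕ}
    (hm : ∀ p : W.branchCurve, W.HasOrd p (m * W.transition (chartIdx p.1) ^ k) (θ p))
    (f : W.functionField) : f ∈ W.H0 θ ↔ m * f ∈ W.fibreSections k := by
  have hcomm (t : W.functionField) : f * (m * t) = m * f * t := by rw [mul_left_comm, mul_assoc]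
  constructor
  · intro hf p hp
    rw [← hcomm]
    exact hf ⟨p, hp⟩ _ (hm ⟨p, hp⟩)
  · intro hf p g hg
    obtain ⟨u, rfl⟩ := hg.eq_unit_mul (hm p)
    rw [mul_left_comm, unit_mul_mem_localRing_iff, hcomm]
    exact hf p p.2

lemma IsSmooth.h0_eq (hW : W.IsSmooth) {θ : W.Divisor} {c : Fin 2 → ℂ} {hc : c ≠ 0} {k : ℕ}
    (hθ : W.LinEquiv θ ((k : ℤ) • W.fibreDivisor c hc)) :
    W.h0 θ = (k + 1) + (k + 1 - 2 * d) + (k + 1 - 4 * d) := by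
  obtain ⟨m, hm0, hm⟩ := hW.exists_hasOrd_of_linEquiv hθ
  rw [← W.finrank_fibreSections]
  exact finrank_eq_of_forall_mem_iff ((LinearEquiv.smulOfNeZero W.functionField
    W.functionField m hm0).restrictScalars ℂ) (mem_H0_iff hm)

open KaehlerDifferential

lemma IsSmooth.residueForm_zero_eq_smul_D (hW : W.IsSmooth) {p : Surface (2 * d)}
    (hp : p ∈ W.branchCurve) {π : W.localRing p} (hπ : W.IsUniformizer p π) :
    ∃ y : (W.localRing p)ˣ, W.residueForm 0 = (((y : W.localRing p) : W.functionField) *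
      W.transition (chartIdx p) ^ (4 * d - 2)) • D ℂ W.functionField π := by
  obtain ⟨v, hv⟩ := hW.D_uniformizer hp hπ
  obtain ⟨ε, hε⟩ := W.residueForm_zero_eq (chartIdx p)
  let ε' : (W.localRing p)ˣ := Units.map (algebraMap ℂ (W.localRing p)).toMonoidHom ε
  have hy : (((ε' * v⁻¹ : (W.localRing p)ˣ) : W.localRing p) : W.functionField) *
      ((v : W.localRing p) : W.functionField) = algebraMap ℂ W.functionField ε := by
    rw [← MulMemClass.coe_mul, ← Units.val_mul, inv_mul_cancel_right]
    rfl
  exact ⟨ε' * v⁻¹, by rw [hv, hε, smul_smul, mul_right_comm, hy]⟩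

lemma IsSmooth.smul_residueForm_mem_iff (hW : W.IsSmooth) (g : W.functionField) :
    g ∈ W.fibreSections (4 * d - 2) ↔ g • W.residueForm 0 ∈ W.regularForms := by
  constructor
  · intro hg p π hπ
    obtain ⟨y, hy⟩ := hW.residueForm_zero_eq_smul_D p.2 hπ
    refine ⟨⟨_, (unit_mul_mem_localRing_iff y _).2 (hg p p.2)⟩, ?_⟩
    rw [hy, smul_smul, mul_left_comm]
  · intro hω p hp
    obtain ⟨π, hπ⟩ := hW.exists_isUniformizer hp
    obtain ⟨y, hy⟩ := hW.residueForm_zero_eq_smul_D hp hπ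
    obtain ⟨f, hf⟩ := hω ⟨p, hp⟩ π hπ
    have hD : D ℂ W.functionField π ≠ 0 := right_ne_zero_of_smul (hy ▸ W.residueForm_ne_zero 0)
    rw [hy, smul_smul, mul_left_comm] at hf
    rw [← unit_mul_mem_localRing_iff y, smul_left_injective W.functionField hD hf]
    exact f.2

lemma IsSmooth.genus_eq (hW : W.IsSmooth) :
    W.genus = Module.finrank ℂ (W.fibreSections (4 * d - 2)) := by
  let L : W.functionField →ₗ[ℂ] Ω[W.functionField⁄ℂ] :=
    (LinearMap.toSpanSingleton W.functionField _ (W.residueForm 0)).restrictScalars ℂ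
  have hL : Function.Bijective L := ⟨smul_left_injective _ (W.residueForm_ne_zero 0), fun ω =>
    (W.exists_eq_smul_residueForm 0 ω).imp fun _ => Eq.symm⟩
  exact (finrank_eq_of_forall_mem_iff (LinearEquiv.ofBijective L hL)
    hW.smul_residueForm_mem_iff).symm

lemma IsSmooth.isCanonical_two_smul (hW : W.IsSmooth) {θ : W.Divisor} {c : Fin 2 → ℂ} {hc : c ≠ 0}
    (hθ : W.LinEquiv θ (((2 * d - 1 : ℕ) : ℤ) • W.fibreDivisor c hc)) :
    W.IsCanonical ((2 : ℤ) • θ) := by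
  obtain ⟨m, hm0, hm⟩ := hW.exists_hasOrd_of_linEquiv hθ
  refine ⟨m ^ 2 • W.residueForm 0, smul_ne_zero (pow_ne_zero 2 hm0) (W.residueForm_ne_zero 0),
    fun p => ?_⟩
  obtain ⟨π, hπ⟩ := hW.exists_isUniformizer p.2
  obtain ⟨y, hy⟩ := hW.residueForm_zero_eq_smul_D p.2 hπ
  have hord := (hW.hasOrd_unit p.2 y).mul p.2 ((hm p).zpow 2)
  rw [zero_add] at hord
  refine ⟨π, _, hπ, ?_, hord⟩
  have hk : 4 * d - 2 = (2 * d - 1) * 2 := by omega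
  rw [hy, smul_smul, hk, zpow_ofNat, mul_pow, pow_mul, mul_left_comm]

end WeierstrassModel

end

theorem lemma7p4 (d : ℕ) (W : WeierstrassModel d) [W.IsIrreducible] (hW : W.IsSmooth)
    (c : Fin 2 → ℂ) (hc : c ≠ 0) :
    (W.genus : ℤ) = 6 * d - 2 ∧
    ∀ θ : W.Divisor, W.LinEquiv θ ((2 * d - 1 : ℤ) • W.fibreDivisor c hc) →
      W.IsThetaCharacteristic θ ∧ Even (W.h0 θ) ∧ W.h0 θ = 2 * d := by
  have hd := W.pos_of_isIrreducible
  constructor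
  · rw [hW.genus_eq, W.finrank_fibreSections]
    omega
  · intro θ hθ
    have hk : (2 * d - 1 : ℤ) = ((2 * d - 1 : ℕ) : ℤ) := by omega
    rw [hk] at hθ
    have hh : W.h0 θ = 2 * d := by
      rw [hW.h0_eq hθ]
      omega
    exact ⟨⟨_, hW.isCanonical_two_smul hθ, hW.linEquiv_refl _⟩, hh ▸ even_two_mul d, hh⟩
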